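/- Fix $\sigma^2>0$. Consider the discrete-time channel $\tilde Y_k = X_k+Z_k$ with $Z_k$ i.i.d. $\mathcal N(0,\sigma^2)$, followed by a one-bit quantizer specified by a Borel set $\mathcal D\subseteq\mathbb R$: $Y_k=1$ if $\tilde Y_k\in\mathcal D$ and $Y_k=0$ otherwise. A code of block length $n$ consists of $M$ codewords $(x_1(m),\dots,x_n(m))\in\mathbb R^n$, a Borel set $\mathcal D$, and a decoder mapping $(Y_1,\dots,Y_n)$ to a guess of the message $m$; its error probability is the one for a uniformly distributed message. A rate $R$ is achievable using power $P>0$ if for every $\varepsilon>0$ there are codes, one for each block length $n$, with $\frac1n\sum_k x_k(m)^2\le P$ for every $m$ and $\frac{\log M}{n}>R-\varepsilon$ for all large $n$, whose error probability tends to $0$ as $n\to\infty$; $C(P)$ is the supremum of all achievable rates. A rate per unit-energy $\dot R$ is achievable if for every $\varepsilon>0$ there are codes (of arbitrary block length), one for each energy $E$, with $\sum_k x_k(m)^2\le E$ for every $m$ and $\frac{\log M}{E}>\dot R-\varepsilon$ for all large $E$, whose error probability tends to $0$ as $E\to\infty$; $\dot C(0)$ is the supremum of all achievable rates per unit-energy.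 ($\log$ is the natural logarithm.) Then $C(P)$, for every $P>0$, and $\dot C(0)$ are finite, and the second derivative of the capacity at zero power is $$\ddot C(0) = 2\lim_{P\downarrow 0}\frac{C(P)-P\,\dot C(0)}{P^2} = -\infty .$$ Consequently the wideband slope is zero. Precisely, let $\frac{E_b}{N_0}(P)=\frac{\log 2}{2\sigma^2}\frac{P}{C(P)}$ be the energy per information-bit, $(E_b/N_0)_{\min}$ its infimum over $P>0$, and $\bar C=\frac{2}{\log 2}C(P)$ the spectral efficiency (in bits per second per Hz) at $E_b/N_0=\frac{E_b}{N_0}(P)$. Then $E_b/N_0$ takes values above and arbitrarily close to $(E_b/N_0)_{\min}$, and $$S_0=\lim_{\frac{E_b}{N_0}\downarrow(\frac{E_b}{N_0})_{\min}}\frac{\bar C(E_b/N_0)}{10\log_{10}\frac{E_b}{N_0}-10\log_{10}\left(\frac{E_b}{N_0}\right)_{\min}}\;10\log_{10}2 = 0 ,$$ in agreement with the expression $\frac{4[\dot C(0)]^2}{-\ddot C(0)}=0$. -/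

import Mathlib

open Set Filter Topology MeasureTheory ProbabilityTheory
open scoped NNReal ENNReal

noncomputable section

namespace OneBit

/-- A block code of length `n` for the additive-noise channel with one-bit output quantization:
a number `M` of messages, an encoder (`enc m k` is the time-`k` channel input for message `m`),
a Borel set `D` specifying the quantizer (output `1` on `D`, output `0` off `D`), and a decoder
that sees only the quantizer outputs. -/
structure Code (n : ℕ) where
  M : ℕ
  enc : Fin M → Fin n → ℝ
  D : Set ℝ
  measurableSet_D : MeasurableSet D
  dec : (Fin n → Bool) → Fin M

/-- The quantizer specified by the set `D`. -/
def quantize (D : Set ℝ) (y : ℝ) : Bool := by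
  classical exact decide (y ∈ D)

/-- The law of `n` i.i.d. centred Gaussian noise samples of variance `v`. -/
def noise (v : ℝ≥0) (n : ℕ) : Measure (Fin n → ℝ) :=
  Measure.pi (fun _ => gaussianReal 0 v)

/-- The probability that the decoder errs when message `m` is sent over the channel with noise
variance `v`. -/
def Code.errorProbOf {n : ℕ} (c : Code n) (v : ℝ≥0) (m : Fin c.M) : ℝ :=
  (noise v n).real {z | c.dec (fun k => quantize c.D (c.enc m k + z k)) ≠ m}

/-- The error probability for a uniformly distributed message. -/
def Code.errorProb {n : ℕ} (c : Code n) (v : ℝ≥0) : ℝ :=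
  (∑ m : Fin c.M, c.errorProbOf v m) / c.M

/-- The rate `R` (nats per channel use) is achievable using power `P` and one-bit quantization:
for every `ε > 0` there are codes, one for each block length, that (for large block lengths)
satisfy the average-power constraint for every message and have rate above `R - ε`, and whose
error probability tends to zero. -/
def AchievableRate (v : ℝ≥0) (P R : ℝ) : Prop :=
  ∀ ε > 0, ∃ c : (n : ℕ) → Code n,
    (∀ᶠ n : ℕ in atTop,
      (∀ m, (1 / (n : ℝ)) * ∑ k, (c n).enc m k ^ 2 ≤ P) ∧
      R - ε < Real.log (c n).M / n) ∧
    Tendsto (fun n => (c n).errorProb v) atTop (𝓝 0)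

/-- The capacity `C(P)` in nats per channel use. -/
def capacity (v : ℝ≥0) (P : ℝ) : ℝ := sSup {R | AchievableRate v P R}

/-- The rate per unit-energy `R` (nats per energy) is achievable using a one-bit quantizer:
for every `ε > 0` there are codes, one for each energy `E` and of arbitrary block length, that
(for large `E`) spend energy at most `E` on every message and have `log M / E` above `R - ε`, and
whose error probability tends to zero as `E` tends to infinity. -/
def AchievableRatePerEnergy (v : ℝ≥0) (R : ℝ) : Prop :=
  ∀ ε > 0, ∃ (n : ℝ → ℕ) (c : (E : ℝ) → Code (n E)),
    (∀ᶠ E : ℝ in atTop,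
      (∀ m, ∑ k, (c E).enc m k ^ 2 ≤ E) ∧
      R - ε < Real.log (c E).M / E) ∧
    Tendsto (fun E => (c E).errorProb v) atTop (𝓝 0)

/-- The capacity per unit-energy `Ċ(0)`. -/
def capacityPerEnergy (v : ℝ≥0) : ℝ := sSup {R | AchievableRatePerEnergy v R}

/-- The quotient whose limit as `P ↓ 0` is the second derivative of the capacity at zero power,
as an extended real number. -/
def secondQuotient (v : ℝ≥0) (P : ℝ) : EReal :=
  ((2 * ((capacity v P - P * capacityPerEnergy v) / P ^ 2) : ℝ) : EReal)

/-- The second derivative `C̈(0)` of the capacity at zero power, in the extended reals. -/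
def capacitySecondDeriv (v : ℝ≥0) : EReal :=
  limUnder (𝓝[>] (0 : ℝ)) (secondQuotient v)

/-- The (normalized) energy per information-bit `E_b / N₀` at power `P`. -/
def energyPerBit (v : ℝ≥0) (P : ℝ) : ℝ :=
  Real.log 2 / (2 * (v : ℝ)) * (P / capacity v P)

/-- The minimum energy per information-bit: the infimum of `E_b / N₀` over all powers. -/
def minEnergyPerBit (v : ℝ≥0) : ℝ := sInf (energyPerBit v '' Ioi 0)

/-- The spectral efficiency, in bits per second per Hz, at power `P`. -/
def spectralEfficiency (v : ℝ≥0) (P : ℝ) : ℝ := 2 / Real.log 2 * capacity v P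

/-- Conversion to decibel. -/
def dB (x : ℝ) : ℝ := 10 * Real.logb 10 x

/-- Powers `P > 0` for which `E_b / N₀` tends to its minimum from above. Limits along this filter
are limits, as `E_b / N₀` decreases to its minimum, along the curve that plots the spectral
efficiency against `E_b / N₀`. -/
def widebandFilter (v : ℝ≥0) : Filter ℝ :=
  comap (energyPerBit v) (𝓝[>] (minEnergyPerBit v)) ⊓ 𝓟 (Ioi 0)

/-- The wideband slope, that is, the slope of the spectral efficiency as a function of `E_b / N₀`
in decibel at the minimum of `E_b / N₀`, exists and equals `S` (bits per second per Hz per 3 dB,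
where 3 dB stands for `10 log₁₀ 2` dB). -/
def HasWidebandSlope (v : ℝ≥0) (S : ℝ) : Prop :=
  (widebandFilter v).NeBot ∧
  Tendsto (fun P => spectralEfficiency v P /
      (dB (energyPerBit v P) - dB (minEnergyPerBit v)) * dB 2)
    (widebandFilter v) (𝓝 S)

end OneBit

end

/-!
Write `v` for the noise variance. The input `x` costs energy `x ^ 2`, and the unquantized output
laws for the inputs `x` and `0` have divergence `x ^ 2 / (2 * v)`. Quantization cannot increase it,
so `1 / (2 * v)` bounds the rate per unit-energy. The theorem follows once this number is shown to
be the value of `capacityPerEnergy v`, while `capacity v P` stays below `P / (2 * v)` by a fraction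
of order at least `1 / log (1 / P)`, which is much larger than `P`.

*Converse.* For any output law `Bernoulli(r)`, which may depend on the code, the variational
inequality `a t ≤ a log (a / b) - a + b exp t` gives `(1 - error) * log M ≤ B + 1`, where `B` bounds
the sum of the divergences of the output letters from `Bernoulli(r)` (`Code.log_M_le`). The loss of
one-bit quantization is quantified in `two_valued_add_quantLoss_le`: the log-likelihood ratio of the
unquantized output is a nondegenerate Gaussian variable, and thus stays away from any function of
one bit with probability at least one half. The loss is a fraction of order `1 / |x|` for large `x`.
To bound the capacity at powers of at least `s`, two kinds of quantizers are distinguished. If both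
outputs have probability at least `s ^ 16` for the input `0`, their law for this input serves as a
reference (`bernDiv_le_of_balanced`): divergences from it are at most of order `log (1 / s)`, so
only inputs of size at most of order `√(log (1 / s))` matter, and these suffer the quantization
loss. Otherwise the reference gives the unlikely output the probability `s ^ 2`
(`bernDiv_le_of_unbalanced`): then about a quarter of `x ^ 2 / (2 * v)` bounds the divergence.
Either way `capacity v P` is at most `P / (2 * v) * (1 - relLoss s)` for `P ≥ s`, where `relLoss s`
is of order `1 / log (1 / s)`.

*Achievability.* Pulses of amplitude `A` are sent at one of `q ≈ exp (A ^ 2 / (2 * v))` positions and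
detected with a threshold slightly below `A`, so that misses and false alarms are rare. A
Gilbert–Varshamov code over the alphabet of pulse positions corrects the remaining errors
(`achievableRate_pulse`). For large `A` the power `A ^ 2 / q` is small, and the rate per energy tends
to `1 / (2 * v)` (`exists_capacity_ge`).

*Conclusion.* The two parts give `capacityPerEnergy v = 1 / (2 * v)`, hence `secondQuotient v P` is
at most `-relLoss P / (v * P)`, which tends to `-∞`. Moreover the minimum energy per bit is `log 2`
and is approached only as `P → 0`, since the converse is uniform over `P ≥ s`. The difference in
decibel to the minimum is at least of order `relLoss P`, and the spectral efficiency is at most of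
order `P`, so the wideband slope is zero because `P / relLoss P` tends to zero.
-/

namespace OneBit

/-! ### The binary-output channel seen by the decoder -/

/-- The probability that the quantizer with set `D` outputs `1` when the channel input is `x`. -/
noncomputable def hitProb (v : ℝ≥0) (D : Set ℝ) (x : ℝ) : ℝ := (gaussianReal x v).real D

/-- The probability mass function of the Bernoulli law with success probability `p`. -/
noncomputable def bern (p : ℝ) (b : Bool) : ℝ := if b then p else 1 - p

lemma hitProb_nonneg (v : ℝ≥0) (D : Set ℝ) (x : ℝ) : 0 ≤ hitProb v D x := measureReal_nonneg

lemma hitProb_le_one (v : ℝ≥0) (D : Set ℝ) (x : ℝ) : hitProb v D x ≤ 1 := measureReal_le_one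

lemma hitProb_compl (v : ℝ≥0) {D : Set ℝ} (hD : MeasurableSet D) (x : ℝ) :
    hitProb v Dᶜ x = 1 - hitProb v D x :=
  probReal_compl_eq_one_sub hD

lemma bern_nonneg {p : ℝ} (h0 : 0 ≤ p) (h1 : p ≤ 1) (b : Bool) : 0 ≤ bern p b := by
  unfold bern; split_ifs <;> linarith

lemma sum_bern (p : ℝ) : ∑ b, bern p b = 1 := by simp [bern]

/-- A sum over binary words of a product of one factor for each letter factorizes. -/
lemma sum_prod_word {n : ℕ} (f : Fin n → Bool → ℝ) :
    ∑ y : Fin n → Bool, ∏ k, f k (y k) = ∏ k, ∑ b, f k b :=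
  (Fintype.prod_sum f).symm

lemma sum_prod_bern {n : ℕ} (p : Fin n → ℝ) :
    ∑ y : Fin n → Bool, ∏ k, bern (p k) (y k) = 1 := by
  rw [sum_prod_word (fun k => bern (p k))]
  exact Finset.prod_eq_one fun k _ => sum_bern _

lemma prod_bern_nonneg {n : ℕ} {p : Fin n → ℝ} (h0 : ∀ k, 0 ≤ p k) (h1 : ∀ k, p k ≤ 1)
    (y : Fin n → Bool) : 0 ≤ ∏ k, bern (p k) (y k) :=
  Finset.prod_nonneg fun k _ => bern_nonneg (h0 k) (h1 k) _

lemma measurableSet_quantize {D : Set ℝ} (hD : MeasurableSet D) (x : ℝ) (b : Bool) :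
    MeasurableSet {z : ℝ | quantize D (x + z) = b} := by
  have h : MeasurableSet ((fun z => x + z) ⁻¹' D) := hD.preimage (measurable_const_add x)
  cases b
  · convert h.compl using 1
    ext z; simp [quantize]
  · convert h using 1
    ext z; simp [quantize]

lemma gaussianReal_quantize (v : ℝ≥0) {D : Set ℝ} (hD : MeasurableSet D) (x : ℝ) (b : Bool) :
    (gaussianReal 0 v).real {z : ℝ | quantize D (x + z) = b} = bern (hitProb v D x) b := by
  have key : (gaussianReal 0 v).real ((fun z => x + z) ⁻¹' D) = hitProb v D x := by
    rw [hitProb, ← map_measureReal_apply (measurable_const_add x) hD, gaussianReal_map_const_add,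
      zero_add]
  have h : MeasurableSet ((fun z => x + z) ⁻¹' D) := hD.preimage (measurable_const_add x)
  cases b
  · have : {z : ℝ | quantize D (x + z) = false} = ((fun z => x + z) ⁻¹' D)ᶜ := by
      ext z; simp [quantize]
    rw [this, probReal_compl_eq_one_sub h, key]; simp [bern]
  · have : {z : ℝ | quantize D (x + z) = true} = ((fun z => x + z) ⁻¹' D) := by
      ext z; simp [quantize]
    rw [this, key]; simp [bern]

lemma noise_quantize_eq (v : ℝ≥0) {n : ℕ} {D : Set ℝ} (hD : MeasurableSet D) (x : Fin n → ℝ)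
    (y : Fin n → Bool) :
    (noise v n).real {z | (fun k => quantize D (x k + z k)) = y}
      = ∏ k, bern (hitProb v D (x k)) (y k) := by
  have : {z : Fin n → ℝ | (fun k => quantize D (x k + z k)) = y}
      = Set.pi univ fun k => {z : ℝ | quantize D (x k + z) = y k} := by
    ext z; simp [funext_iff]
  rw [this, noise, measureReal_def, Measure.pi_pi, ENNReal.toReal_prod]
  exact Finset.prod_congr rfl fun k _ => gaussianReal_quantize v hD (x k) (y k)

/-- The error probability in terms of the binary-output channel seen by the decoder. -/
lemma Code.errorProbOf_eq {n : ℕ} (c : Code n) (v : ℝ≥0) (m : Fin c.M) :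
    c.errorProbOf v m
      = ∑ y with c.dec y ≠ m, ∏ k, bern (hitProb v c.D (c.enc m k)) (y k) := by
  classical
  have hms : ∀ y : Fin n → Bool,
      MeasurableSet {z : Fin n → ℝ | (fun k => quantize c.D (c.enc m k + z k)) = y} := by
    intro y
    have : {z : Fin n → ℝ | (fun k => quantize c.D (c.enc m k + z k)) = y}
        = Set.pi univ fun k => {z : ℝ | quantize c.D (c.enc m k + z) = y k} := by
      ext z; simp [funext_iff]
    rw [this]
    exact MeasurableSet.univ_pi fun k => measurableSet_quantize c.measurableSet_D _ _
  have hU : {z : Fin n → ℝ | c.dec (fun k => quantize c.D (c.enc m k + z k)) ≠ m}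
      = ⋃ y ∈ Finset.univ.filter (fun y => c.dec y ≠ m),
        {z : Fin n → ℝ | (fun k => quantize c.D (c.enc m k + z k)) = y} := by
    ext z; simp
  have : IsProbabilityMeasure (noise v n) := by unfold noise; infer_instance
  rw [Code.errorProbOf, hU, measureReal_biUnion_finset]
  · exact Finset.sum_congr rfl fun y _ => noise_quantize_eq v c.measurableSet_D _ y
  · intro y _ y' _ hyy'
    refine Set.disjoint_left.mpr fun z hz hz' => hyy' ?_
    exact hz.symm.trans hz'
  · exact fun y _ => hms y

/-- The probability of a correct decision in terms of the binary-output channel. -/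
lemma Code.one_sub_errorProbOf {n : ℕ} (c : Code n) (v : ℝ≥0) (m : Fin c.M) :
    1 - c.errorProbOf v m
      = ∑ y with c.dec y = m, ∏ k, bern (hitProb v c.D (c.enc m k)) (y k) := by
  rw [c.errorProbOf_eq, ← sum_prod_bern (fun k => hitProb v c.D (c.enc m k)),
    ← Finset.sum_filter_add_sum_filter_not Finset.univ (fun y => c.dec y = m)]
  ring

lemma Code.errorProbOf_nonneg {n : ℕ} (c : Code n) (v : ℝ≥0) (m : Fin c.M) :
    0 ≤ c.errorProbOf v m := measureReal_nonneg

lemma Code.errorProb_nonneg {n : ℕ} (c : Code n) (v : ℝ≥0) : 0 ≤ c.errorProb v :=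
  div_nonneg (Finset.sum_nonneg fun m _ => c.errorProbOf_nonneg v m) (Nat.cast_nonneg _)

/-- A code has at least one message, since its decoder always produces one. -/
lemma Code.M_pos {n : ℕ} (c : Code n) : 0 < c.M := Fin.pos (c.dec fun _ => true)

/-! ### The converse for a given code -/

/-- The Kullback–Leibler divergence, in nats, between the Bernoulli laws with success
probabilities `p` and `r`. It has this meaning when `p` is absolutely continuous with respect to
`r`. -/
noncomputable def bernDiv (p r : ℝ) : ℝ := ∑ b, bern p b * Real.log (bern p b / bern r b)

lemma bernDiv_eq (p r : ℝ) :
    bernDiv p r = p * Real.log (p / r) + (1 - p) * Real.log ((1 - p) / (1 - r)) := by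
  simp [bernDiv, bern]

lemma bernDiv_one_sub (p r : ℝ) : bernDiv (1 - p) (1 - r) = bernDiv p r := by
  simp only [bernDiv_eq, sub_sub_cancel]; ring

/-- The expectation of a function of a single letter under a product of Bernoulli laws. -/
lemma sum_prod_bern_mul {n : ℕ} (p : Fin n → ℝ) (j : Fin n) (f : Bool → ℝ) :
    ∑ y : Fin n → Bool, (∏ k, bern (p k) (y k)) * f (y j) = ∑ b, bern (p j) b * f b := by
  have h : ∀ y : Fin n → Bool, (∏ k, bern (p k) (y k)) * f (y j)
      = ∏ k, bern (p k) (y k) * (if k = j then f (y k) else 1) := by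
    intro y
    rw [Finset.prod_mul_distrib, Finset.prod_ite_eq']
    simp
  simp_rw [h]
  rw [sum_prod_word (fun k b => bern (p k) b * (if k = j then f b else 1)),
    Finset.prod_eq_single j]
  · simp
  · intro k _ hk
    simp [hk, bern]
  · simp

/-- The elementary inequality behind the variational bound on the divergence. -/
lemma mul_le_mul_log_sub_add {a b : ℝ} (ha : 0 ≤ a) (hb : 0 ≤ b) (hab : b = 0 → a = 0) (t : ℝ) :
    a * t ≤ a * Real.log (a / b) - a + b * Real.exp t := by
  rcases ha.eq_or_lt with rfl | ha
  · simpa using mul_nonneg hb (Real.exp_pos t).le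
  have hb : 0 < b := hb.lt_of_ne fun h => ha.ne' (hab h.symm)
  have h := Real.add_one_le_exp (t - Real.log (a / b))
  rw [Real.exp_sub, Real.exp_log (by positivity)] at h
  have h2 := mul_le_mul_of_nonneg_left h ha.le
  have h3 : a * (Real.exp t / (a / b)) = b * Real.exp t := by field_simp
  rw [h3] at h2
  linarith

/-- `p` is a probability whose Bernoulli law is absolutely continuous with respect to that of
the probability `r`. -/
structure BernAC (p r : ℝ) : Prop where
  nonneg : 0 ≤ p
  le_one : p ≤ 1
  ac : ∀ b, bern r b = 0 → bern p b = 0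

/-- The probability of a set of words under a product of Bernoulli laws is bounded by means of its
probability under another product and of the divergence between the two products, which is the sum
of the divergences between the letters. -/
lemma mul_sum_prod_bern_le {n : ℕ} {p : Fin n → ℝ} {r : ℝ} (h : ∀ k, BernAC (p k) r)
    (hr0 : 0 ≤ r) (hr1 : r ≤ 1)
    (A : Finset (Fin n → Bool)) (T : ℝ) :
    T * ∑ y ∈ A, ∏ k, bern (p k) (y k)
      ≤ ∑ k, bernDiv (p k) r + Real.exp T * ∑ y ∈ A, ∏ k, bern r (y k) := by
  classical
  set W : (Fin n → Bool) → ℝ := fun y => ∏ k, bern (p k) (y k) with hW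
  set V : (Fin n → Bool) → ℝ := fun y => ∏ k, bern r (y k) with hV
  have hW0 : ∀ y, 0 ≤ W y := fun y => prod_bern_nonneg (fun k => (h k).nonneg)
    (fun k => (h k).le_one) y
  have hV0 : ∀ y, 0 ≤ V y := fun y => prod_bern_nonneg (fun _ => hr0) (fun _ => hr1) y
  have hac : ∀ y, V y = 0 → W y = 0 := by
    intro y hy
    obtain ⟨k, -, hk⟩ := Finset.prod_eq_zero_iff.mp hy
    exact Finset.prod_eq_zero (Finset.mem_univ k) ((h k).ac _ hk)
  have hlog : ∀ y, W y * Real.log (W y / V y)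
      = ∑ k, W y * Real.log (bern (p k) (y k) / bern r (y k)) := by
    intro y
    rcases (hW0 y).eq_or_lt with h0 | h0
    · simp [← h0]
    · rw [← Finset.mul_sum, hW, hV, ← Finset.prod_div_distrib, Real.log_prod]
      intro k _
      have h1 : bern (p k) (y k) ≠ 0 := (Finset.prod_ne_zero_iff.mp h0.ne') k (Finset.mem_univ k)
      exact div_ne_zero h1 fun h2 => h1 ((h k).ac _ h2)
  have hsumlog : ∑ y, W y * Real.log (W y / V y) = ∑ k, bernDiv (p k) r := by
    simp_rw [hlog]
    rw [Finset.sum_comm]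
    exact Finset.sum_congr rfl fun k _ =>
      sum_prod_bern_mul p k (fun b => Real.log (bern (p k) b / bern r b))
  have hW1 : ∑ y, W y = 1 := sum_prod_bern p
  have hV1 : ∑ y, V y = 1 := sum_prod_bern fun _ => r
  have hpt : ∀ y, W y * (if y ∈ A then T else 0)
      ≤ W y * Real.log (W y / V y) - W y + V y + (if y ∈ A then V y * Real.exp T else 0) := by
    intro y
    have h1 := mul_le_mul_log_sub_add (hW0 y) (hV0 y) (hac y) (if y ∈ A then T else 0)
    have h2 := hV0 y
    split_ifs at h1 ⊢ with hy
    · linarith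
    · simpa using h1
  have hsum := Finset.sum_le_sum fun y (_ : y ∈ Finset.univ) => hpt y
  simp only [Finset.sum_add_distrib, Finset.sum_sub_distrib, mul_ite, mul_zero,
    Finset.sum_ite_mem, Finset.univ_inter, hsumlog, hW1, hV1] at hsum
  rw [← Finset.sum_mul, ← Finset.sum_mul] at hsum
  linarith

/-- The converse for a given code: the divergence of the channel output from the output of
`n` independent Bernoulli variables bounds the number of messages. -/
lemma Code.log_M_le {n : ℕ} (c : Code n) (v : ℝ≥0) {r B : ℝ}
    (hr0 : 0 ≤ r) (hr1 : r ≤ 1) (h : ∀ x, BernAC (hitProb v c.D x) r)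
    (hB : ∀ m, ∑ k, bernDiv (hitProb v c.D (c.enc m k)) r ≤ B) :
    (1 - c.errorProb v) * Real.log c.M ≤ B + 1 := by
  classical
  have hM : (0 : ℝ) < c.M := by exact_mod_cast c.M_pos
  have hm : ∀ m : Fin c.M, Real.log c.M * (1 - c.errorProbOf v m)
      ≤ B + c.M * ∑ y with c.dec y = m, ∏ k, bern r (y k) := by
    intro m
    rw [c.one_sub_errorProbOf]
    -- With `exp T = M` the reference probabilities of the decoding regions contribute
    -- at most `1` on average over the messages.
    refine (mul_sum_prod_bern_le (fun k => h (c.enc m k)) hr0 hr1 _ _).trans ?_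
    rw [Real.exp_log hM]
    exact add_le_add_left (hB m) _
  have hsum := Finset.sum_le_sum fun m (_ : m ∈ Finset.univ) => hm m
  rw [← Finset.mul_sum, Finset.sum_add_distrib, ← Finset.mul_sum, Finset.sum_sub_distrib,
    Finset.sum_fiberwise, sum_prod_bern] at hsum
  simp only [Finset.sum_const, Finset.card_univ, Fintype.card_fin, nsmul_eq_mul, mul_one] at hsum
  have he : ∑ m, c.errorProbOf v m = c.errorProb v * c.M := by
    rw [Code.errorProb]; field_simp
  rw [he] at hsum
  have : c.M * ((1 - c.errorProb v) * Real.log c.M) ≤ c.M * (B + 1) := by linarith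
  exact le_of_mul_le_mul_left this hM

/-! ### The divergence lost by one-bit quantization -/

lemma sq_div_le_exp_neg (u : ℝ) : u ^ 2 / (2 + |u|) ≤ Real.exp (-u) - 1 + u := by
  rcases le_total 0 u with hu | hu
  · have h := Real.le_log_one_add_of_nonneg (x := Real.exp u - 1) (by
      linarith [Real.one_le_exp hu])
    rw [add_sub_cancel, Real.log_exp, div_le_iff₀ (by linarith [Real.one_le_exp hu])] at h
    have h2 : Real.exp u * Real.exp (-u) = 1 := by rw [← Real.exp_add]; simp
    have h3 : 2 - u ≤ (2 + u) * Real.exp (-u) := by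
      nlinarith [Real.exp_pos (-u)]
    rw [abs_of_nonneg hu, div_le_iff₀ (by linarith)]
    nlinarith
  · have h := Real.quadratic_le_exp_of_nonneg (x := -u) (by linarith)
    refine (div_le_div_of_nonneg_left (sq_nonneg u) two_pos
      (by linarith [abs_nonneg u])).trans ?_
    nlinarith

lemma sq_div_two_add_mono {s t : ℝ} (hs : 0 ≤ s) (hst : s ≤ t) :
    s ^ 2 / (2 + s) ≤ t ^ 2 / (2 + t) := by
  rw [div_le_div_iff₀ (by linarith) (by linarith)]
  nlinarith [mul_nonneg hs (hs.trans hst),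
    mul_nonneg (mul_nonneg hs (hs.trans hst)) (sub_nonneg.mpr hst)]

/-- A lower bound on the divergence lost when a Gaussian observation of variance `v` and mean
either `0` or `x` is quantized to a single bit. -/
noncomputable def quantLoss (v : ℝ≥0) (x : ℝ) : ℝ :=
  (|x| / (4 * √v)) ^ 2 / (2 + |x| / (4 * √v)) / 2

lemma gaussianPDFReal_le {v : ℝ≥0} (hv : 0 < v) (x y : ℝ) :
    gaussianPDFReal x v y ≤ 1 / (2 * √v) := by
  have hv' : (0 : ℝ) < v := hv
  have hs : 0 < √(v : ℝ) := Real.sqrt_pos.mpr hv'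
  have h2 : 2 * √(v : ℝ) ≤ √(2 * Real.pi * v) := by
    rw [Real.sqrt_mul (by positivity)]
    gcongr
    exact Real.le_sqrt_of_sq_le (by linarith [Real.pi_gt_three])
  unfold gaussianPDFReal
  have h1 : Real.exp (-(y - x) ^ 2 / (2 * v)) ≤ 1 :=
    Real.exp_le_one_iff.mpr (div_nonpos_of_nonpos_of_nonneg (by nlinarith [sq_nonneg (y - x)])
      (by positivity))
  calc (√(2 * Real.pi * v))⁻¹ * Real.exp (-(y - x) ^ 2 / (2 * v))
      ≤ (2 * √(v : ℝ))⁻¹ * 1 := by gcongr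
    _ = 1 / (2 * √v) := by simp

/-- An interval whose length is half a standard deviation has Gaussian probability at most
`1 / 4`. -/
lemma gaussianReal_ball_le {v : ℝ≥0} (hv : 0 < v) (x c : ℝ) :
    (gaussianReal x v).real (Metric.ball c (√v / 4)) ≤ 1 / 4 := by
  have hs : 0 < √(v : ℝ) := Real.sqrt_pos.mpr (by exact_mod_cast hv)
  have hvol : volume.real (Metric.ball c (√(v : ℝ) / 4)) = √v / 2 := by
    rw [Real.volume_real_ball (by positivity)]; ring
  have h : ∫ y in Metric.ball c (√(v : ℝ) / 4), gaussianPDFReal x v y ≤ 1 / 4 := by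
    refine (le_abs_self _).trans ?_
    have := norm_setIntegral_le_of_norm_le_const (μ := volume) (s := Metric.ball c (√(v : ℝ) / 4))
      (f := gaussianPDFReal x v) (C := 1 / (2 * √v)) measure_ball_lt_top (fun y _ => by
        rw [Real.norm_of_nonneg (gaussianPDFReal_nonneg x v y)]
        exact gaussianPDFReal_le hv x y)
    rw [hvol] at this
    refine this.trans (le_of_eq ?_)
    field_simp; norm_num
  rw [measureReal_def, gaussianReal_apply_eq_integral x hv.ne']
  exact ENNReal.toReal_le_of_le_ofReal (by norm_num) (ENNReal.ofReal_le_ofReal h)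

lemma integral_two_valued (v : ℝ≥0) {D : Set ℝ} (hD : MeasurableSet D) (x a b : ℝ) :
    ∫ y, (D.indicator (fun _ => a) y + Dᶜ.indicator (fun _ => b) y) ∂gaussianReal x v
      = hitProb v D x * a + (1 - hitProb v D x) * b := by
  rw [integral_add ((integrable_const a).indicator hD) ((integrable_const b).indicator hD.compl),
    integral_indicator_const _ hD, integral_indicator_const _ hD.compl,
    probReal_compl_eq_one_sub hD]
  rfl

/-- The log-likelihood ratio of the Gaussian laws with variance `v` and means `x` and `0`. -/
noncomputable def llr (v : ℝ≥0) (x y : ℝ) : ℝ := x * y / v - x ^ 2 / (2 * v)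

lemma gaussianPDFReal_mul_exp_neg_llr {v : ℝ≥0} (hv : 0 < v) (x y : ℝ) :
    gaussianPDFReal x v y * Real.exp (-llr v x y) = gaussianPDFReal 0 v y := by
  have hv' : (v : ℝ) ≠ 0 := by exact_mod_cast hv.ne'
  unfold gaussianPDFReal llr
  rw [mul_assoc, ← Real.exp_add]
  congr 2
  field_simp; ring

lemma integral_llr {v : ℝ≥0} (hv : 0 < v) (x : ℝ) :
    Integrable (llr v x) (gaussianReal x v) ∧
      ∫ y, llr v x y ∂gaussianReal x v = x ^ 2 / (2 * v) := by
  have hv' : (v : ℝ) ≠ 0 := by exact_mod_cast hv.ne'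
  have hid : Integrable (fun y : ℝ => y) (gaussianReal x v) :=
    (memLp_id_gaussianReal (μ := x) (v := v) 1).integrable le_rfl
  have h1 : Integrable (fun y : ℝ => x * y / v) (gaussianReal x v) :=
    (hid.const_mul x).div_const _
  refine ⟨h1.sub (integrable_const _), ?_⟩
  unfold llr
  rw [integral_sub h1 (integrable_const _), integral_div, integral_const_mul,
    integral_id_gaussianReal]
  simp only [integral_const, probReal_univ, smul_eq_mul, one_mul]
  field_simp; ring

lemma integrable_exp_neg_llr (v : ℝ≥0) (x : ℝ) :
    Integrable (fun y => Real.exp (-llr v x y)) (gaussianReal x v) := by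
  have h := (integrable_exp_mul_gaussianReal (μ := x) (v := v) (-(x / v))).mul_const
    (Real.exp (x ^ 2 / (2 * v)))
  refine h.congr (ae_of_all _ fun y => ?_)
  simp only [llr]
  rw [← Real.exp_add]; congr 1; ring

/-- A two-valued function of a Gaussian observation stays away from the log-likelihood ratio
with probability at least one half. This turns the variational bound on the divergence of the
quantized observations into one with a loss. -/
lemma two_valued_add_quantLoss_le {v : ℝ≥0} (hv : 0 < v) {D : Set ℝ} (hD : MeasurableSet D)
    (x a b : ℝ) :
    hitProb v D x * a + (1 - hitProb v D x) * b + quantLoss v x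
      ≤ x ^ 2 / (2 * v)
        + (hitProb v D 0 * Real.exp a + (1 - hitProb v D 0) * Real.exp b - 1) := by
  have hv' : (0 : ℝ) < v := by exact_mod_cast hv
  have hs : 0 < √(v : ℝ) := Real.sqrt_pos.mpr hv'
  have hss : √(v : ℝ) * √(v : ℝ) = v := Real.mul_self_sqrt hv'.le
  set t : ℝ := |x| / (4 * √v) with ht
  have ht0 : 0 ≤ t := by positivity
  -- The two intervals on which the log-likelihood ratio is close to `a` or to `b`.
  set ca : ℝ := (a + x ^ 2 / (2 * v)) * v / x with hca
  set cb : ℝ := (b + x ^ 2 / (2 * v)) * v / x with hcb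
  set G : Set ℝ := (Metric.ball ca (√v / 4) ∪ Metric.ball cb (√v / 4))ᶜ with hG
  have hGm : MeasurableSet G := (Metric.isOpen_ball.union Metric.isOpen_ball).measurableSet.compl
  have hGp : 1 / 2 ≤ (gaussianReal x v).real G := by
    rw [hG, probReal_compl_eq_one_sub (Metric.isOpen_ball.union Metric.isOpen_ball).measurableSet]
    linarith [measureReal_union_le (μ := gaussianReal x v) (Metric.ball ca (√v / 4))
      (Metric.ball cb (√v / 4)), gaussianReal_ball_le hv x ca, gaussianReal_ball_le hv x cb]
  have hfar : ∀ e y : ℝ, y ∉ Metric.ball ((e + x ^ 2 / (2 * v)) * v / x) (√v / 4) →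
      t ≤ |llr v x y - e| := by
    intro e y hy
    rcases eq_or_ne x 0 with hx | hx
    · rw [ht, hx]; simp
    rw [Metric.mem_ball, not_lt, Real.dist_eq] at hy
    have h1 : llr v x y - e = x / v * (y - (e + x ^ 2 / (2 * v)) * v / x) := by
      unfold llr; field_simp; ring
    rw [h1, abs_mul, abs_div, abs_of_pos hv']
    calc t = |x| / v * (√v / 4) := by
          have : |x| / (v : ℝ) = |x| / (√v * √v) := by rw [hss]
          rw [ht, this]; field_simp
      _ ≤ _ := by gcongr
  set L' : ℝ → ℝ := fun y => D.indicator (fun _ => a) y + Dᶜ.indicator (fun _ => b) y with hL'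
  set F : ℝ → ℝ := fun y => D.indicator (fun y => Real.exp a * Real.exp (-llr v x y)) y
    + Dᶜ.indicator (fun y => Real.exp b * Real.exp (-llr v x y)) y with hF
  have hFint : Integrable F (gaussianReal x v) :=
    (((integrable_exp_neg_llr v x).const_mul _).indicator hD).add
      (((integrable_exp_neg_llr v x).const_mul _).indicator hD.compl)
  have hL'int : Integrable L' (gaussianReal x v) :=
    ((integrable_const a).indicator hD).add ((integrable_const b).indicator hD.compl)
  obtain ⟨hLint, hLval⟩ := integral_llr hv x
  have hFval : ∫ y, F y ∂gaussianReal x v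
      = hitProb v D 0 * Real.exp a + (1 - hitProb v D 0) * Real.exp b := by
    rw [← integral_two_valued v hD, integral_gaussianReal_eq_integral_smul hv.ne',
      integral_gaussianReal_eq_integral_smul hv.ne']
    congr 1
    ext y
    rw [← gaussianPDFReal_mul_exp_neg_llr hv x y, hF]
    by_cases hy : y ∈ D <;> simp [hy] <;> ring
  -- With `U = llr - L'`, the right side is `exp (-U) - 1 + U`, which is bounded below by
  -- `sq_div_le_exp_neg`; its expectation is the difference of the two sides of the claim.
  have hpt : ∀ y, G.indicator (fun _ => t ^ 2 / (2 + t)) y ≤ F y - 1 + (llr v x y - L' y) := by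
    intro y
    have key : ∀ e, t ≤ |llr v x y - e| ∨ y ∉ G → G.indicator (fun _ => t ^ 2 / (2 + t)) y
        ≤ Real.exp e * Real.exp (-llr v x y) - 1 + (llr v x y - e) := by
      intro e he
      have h1 := sq_div_le_exp_neg (llr v x y - e)
      have h2 : Real.exp (-(llr v x y - e)) = Real.exp e * Real.exp (-llr v x y) := by
        rw [← Real.exp_add]; congr 1; ring
      rw [h2] at h1
      refine le_trans ?_ h1
      by_cases hy : y ∈ G
      · rw [indicator_of_mem hy, ← sq_abs (llr v x y - e)]
        exact sq_div_two_add_mono ht0 (he.resolve_right (not_not.mpr hy))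
      · rw [indicator_of_notMem hy]; positivity
    have hmem : y ∈ G → y ∉ Metric.ball ca (√v / 4) ∧ y ∉ Metric.ball cb (√v / 4) := by
      intro h; rw [hG, mem_compl_iff, mem_union, not_or] at h; exact h
    by_cases hy : y ∈ D
    · have := key a (by
        by_cases h : y ∈ G
        · exact Or.inl (hfar a y (hmem h).1)
        · exact Or.inr h)
      simpa [hF, hL', hy] using this
    · have := key b (by
        by_cases h : y ∈ G
        · exact Or.inl (hfar b y (hmem h).2)
        · exact Or.inr h)
      simpa [hF, hL', hy] using this
  have hi1 : Integrable (fun y => F y - 1) (gaussianReal x v) := hFint.sub (integrable_const 1)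
  have hi2 : Integrable (fun y => llr v x y - L' y) (gaussianReal x v) := hLint.sub hL'int
  have hint := integral_mono (μ := gaussianReal x v)
    ((integrable_const (t ^ 2 / (2 + t))).indicator hGm)
    (hi1.add hi2) hpt
  have hI : ∫ y, (F y - 1 + (llr v x y - L' y)) ∂gaussianReal x v
      = hitProb v D 0 * Real.exp a + (1 - hitProb v D 0) * Real.exp b - 1
        + (x ^ 2 / (2 * v) - (hitProb v D x * a + (1 - hitProb v D x) * b)) := by
    rw [integral_add hi1 hi2, integral_sub hFint (integrable_const 1), integral_sub hLint hL'int, hFval, hLval,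
      integral_two_valued v hD]
    simp
  have hloss : quantLoss v x ≤ (gaussianReal x v).real G * (t ^ 2 / (2 + t)) := by
    have h0 : 0 ≤ t ^ 2 / (2 + t) := by positivity
    rw [quantLoss, ← ht]
    nlinarith
  rw [integral_indicator_const _ hGm, smul_eq_mul] at hint
  have hint' := hint.trans_eq hI
  linarith

lemma quantLoss_nonneg (v : ℝ≥0) (x : ℝ) : 0 ≤ quantLoss v x := by
  unfold quantLoss; positivity

lemma hitProb_eq_zero_iff {v : ℝ≥0} (hv : 0 < v) (D : Set ℝ) (x : ℝ) :
    hitProb v D x = 0 ↔ volume D = 0 := by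
  rw [hitProb, measureReal_eq_zero_iff]
  exact ⟨fun h => gaussianReal_absolutelyContinuous' x hv.ne' h,
    fun h => gaussianReal_absolutelyContinuous x hv.ne' h⟩

lemma hitProb_eq_one_iff {v : ℝ≥0} (hv : 0 < v) {D : Set ℝ} (hD : MeasurableSet D) (x : ℝ) :
    hitProb v D x = 1 ↔ volume Dᶜ = 0 := by
  rw [← hitProb_eq_zero_iff hv Dᶜ x, hitProb_compl v hD, sub_eq_zero, eq_comm]

lemma bernAC_hitProb_zero {v : ℝ≥0} (hv : 0 < v) {D : Set ℝ} (hD : MeasurableSet D) (x : ℝ) :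
    BernAC (hitProb v D x) (hitProb v D 0) where
  nonneg := hitProb_nonneg v D x
  le_one := hitProb_le_one v D x
  ac b hb := by
    cases b
    · simp only [bern, Bool.false_eq_true, if_false, sub_eq_zero] at hb ⊢
      rw [eq_comm, hitProb_eq_one_iff hv hD] at hb ⊢
      exact hb
    · simp only [bern, if_true] at hb ⊢
      rw [hitProb_eq_zero_iff hv] at hb ⊢
      exact hb

/-- The data processing inequality for one-bit quantization, with a loss. -/
lemma bernDiv_hitProb_zero_le {v : ℝ≥0} (hv : 0 < v) {D : Set ℝ} (hD : MeasurableSet D) (x : ℝ) :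
    bernDiv (hitProb v D x) (hitProb v D 0) ≤ x ^ 2 / (2 * v) - quantLoss v x := by
  set p := hitProb v D x with hp
  set r := hitProb v D 0 with hr
  by_cases h0 : volume D = 0
  · have h1 : p = 0 := (hitProb_eq_zero_iff hv D x).mpr h0
    have h2 : r = 0 := (hitProb_eq_zero_iff hv D 0).mpr h0
    have h := two_valued_add_quantLoss_le hv hD x 0 0
    rw [← hp, ← hr, h1, h2] at h
    rw [bernDiv_eq, h1, h2]
    simp at h ⊢; linarith
  by_cases h0' : volume Dᶜ = 0
  · have h1 : p = 1 := (hitProb_eq_one_iff hv hD x).mpr h0'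
    have h2 : r = 1 := (hitProb_eq_one_iff hv hD 0).mpr h0'
    have h := two_valued_add_quantLoss_le hv hD x 0 0
    rw [← hp, ← hr, h1, h2] at h
    rw [bernDiv_eq, h1, h2]
    simp at h ⊢; linarith
  have hp0 : 0 < p := (hitProb_nonneg v D x).lt_of_ne
    fun h => h0 ((hitProb_eq_zero_iff hv D x).mp h.symm)
  have hr0 : 0 < r := (hitProb_nonneg v D 0).lt_of_ne
    fun h => h0 ((hitProb_eq_zero_iff hv D 0).mp h.symm)
  have hp1 : 0 < 1 - p := sub_pos.mpr <| (hitProb_le_one v D x).lt_of_ne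
    fun h => h0' ((hitProb_eq_one_iff hv hD x).mp h)
  have hr1 : 0 < 1 - r := sub_pos.mpr <| (hitProb_le_one v D 0).lt_of_ne
    fun h => h0' ((hitProb_eq_one_iff hv hD 0).mp h)
  have h := two_valued_add_quantLoss_le hv hD x (Real.log (p / r)) (Real.log ((1 - p) / (1 - r)))
  rw [← hp, ← hr, Real.exp_log (by positivity), Real.exp_log (by positivity),
    mul_div_cancel₀ _ hr0.ne', mul_div_cancel₀ _ hr1.ne'] at h
  rw [bernDiv_eq]
  linarith

/-! ### Converse bounds on the capacities -/

lemma div_mul_log_le {p r : ℝ} (hp0 : 0 ≤ p) (hp1 : p ≤ 1) (hr : 0 < r) :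
    p * Real.log (p / r) ≤ p * -Real.log r := by
  rcases hp0.eq_or_lt with rfl | hp
  · simp
  rw [Real.log_div hp.ne' hr.ne']
  exact mul_le_mul_of_nonneg_left (by linarith [Real.log_nonpos hp0 hp1]) hp0

lemma quantLoss_eq {v : ℝ≥0} (hv : 0 < v) (x : ℝ) :
    quantLoss v x = x ^ 2 / (2 * v) * (1 / (16 * (2 + |x| / (4 * √v)))) := by
  have hv' : (0 : ℝ) < v := by exact_mod_cast hv
  have h : (|x| / (4 * √(v : ℝ))) ^ 2 = x ^ 2 / (16 * v) := by
    rw [div_pow, mul_pow, Real.sq_sqrt hv'.le, sq_abs]; norm_num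
  have h0 : 0 ≤ |x| / (4 * √(v : ℝ)) := by positivity
  rw [quantLoss, h]
  field_simp

/-- If the two outputs are not too unlikely for the input `0`, then the quantizer loses a
noticeable fraction of the divergence: inputs of moderate size because of `quantLoss`, and large
ones because the divergence of the outputs is bounded. -/
lemma bernDiv_le_of_balanced {v : ℝ≥0} (hv : 0 < v) {D : Set ℝ} (hD : MeasurableSet D) {w : ℝ}
    (hw : 0 ≤ w) (h0 : Real.exp (-w) ≤ hitProb v D 0) (h1 : Real.exp (-w) ≤ 1 - hitProb v D 0)
    (x : ℝ) :
    bernDiv (hitProb v D x) (hitProb v D 0) ≤ (1 - 1 / (36 + 4 * w)) / (2 * v) * x ^ 2 := by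
  have hv' : (0 : ℝ) < v := by exact_mod_cast hv
  have hx : 0 ≤ x ^ 2 / (2 * v) := by positivity
  have e : (1 - 1 / (36 + 4 * w)) / (2 * v) * x ^ 2
      = (1 - 1 / (36 + 4 * w)) * (x ^ 2 / (2 * v)) := by ring
  rw [e]
  rcases le_total (4 * v * w) (x ^ 2) with hlarge | hsmall
  · have hr0 : 0 < hitProb v D 0 := (Real.exp_pos _).trans_le h0
    have hr1 : 0 < 1 - hitProb v D 0 := (Real.exp_pos _).trans_le h1
    have hp0 := hitProb_nonneg v D x
    have hp1 := hitProb_le_one v D x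
    have l0 : -Real.log (hitProb v D 0) ≤ w := by
      linarith [(Real.le_log_iff_exp_le hr0).mpr h0]
    have l1 : -Real.log (1 - hitProb v D 0) ≤ w := by
      linarith [(Real.le_log_iff_exp_le hr1).mpr h1]
    have hb : bernDiv (hitProb v D x) (hitProb v D 0) ≤ w := by
      rw [bernDiv_eq]
      have a0 := div_mul_log_le hp0 hp1 hr0
      have a1 := div_mul_log_le (sub_nonneg.mpr hp1) (sub_le_self 1 hp0) hr1
      have b0 := mul_le_mul_of_nonneg_left l0 hp0
      have b1 := mul_le_mul_of_nonneg_left l1 (sub_nonneg.mpr hp1)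
      linarith
    have hw2 : w ≤ 1 / 2 * (x ^ 2 / (2 * v)) := by
      have : 1 / 2 * (x ^ 2 / (2 * v)) = x ^ 2 / (4 * v) := by ring
      rw [this, le_div_iff₀ (by positivity)]
      linarith
    have h2 : 1 / (36 + 4 * w) ≤ 1 / 2 :=
      one_div_le_one_div_of_le two_pos (by linarith)
    calc _ ≤ w := hb
      _ ≤ 1 / 2 * (x ^ 2 / (2 * v)) := hw2
      _ ≤ _ := mul_le_mul_of_nonneg_right (by linarith) hx
  · have hb := bernDiv_hitProb_zero_le hv hD x
    have ht : |x| / (4 * √(v : ℝ)) ≤ (1 + w) / 4 := by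
      have hs : 0 < √(v : ℝ) := Real.sqrt_pos.mpr hv'
      have h1 : |x| ≤ √v * (1 + w) := by
        refine abs_le_of_sq_le_sq ?_ (by positivity)
        rw [mul_pow, Real.sq_sqrt hv'.le]
        nlinarith [mul_nonneg hv'.le (sq_nonneg (1 - w))]
      rw [div_le_div_iff₀ (by positivity) (by norm_num)]
      linarith
    have h0' : 0 ≤ |x| / (4 * √(v : ℝ)) := by positivity
    have h2 : 1 / (36 + 4 * w) ≤ 1 / (16 * (2 + |x| / (4 * √(v : ℝ)))) :=
      one_div_le_one_div_of_le (by positivity) (by linarith)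
    rw [quantLoss_eq hv] at hb
    have := mul_le_mul_of_nonneg_left h2 hx
    linarith

/-- If one output is very unlikely for the input `0`, then the output distribution is compared
with a Bernoulli law that makes it only moderately unlikely. -/
lemma bernDiv_le_of_unbalanced {v : ℝ≥0} (hv : 0 < v) {D : Set ℝ} (hD : MeasurableSet D) {s : ℝ}
    (hs : 0 < s) (hs2 : s ≤ 1 / 2) (h0 : hitProb v D 0 ≤ s ^ 16) (x : ℝ) :
    bernDiv (hitProb v D x) (s ^ 2) ≤ 1 / (8 * v) * x ^ 2 + 3 * s ^ 2 := by
  have hp0 := hitProb_nonneg v D x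
  have hp1 := hitProb_le_one v D x
  -- The weight `8 * log (1 / s)` on the unlikely output bounds its probability for the input `x`.
  have h := two_valued_add_quantLoss_le hv hD x (8 * -Real.log s) 0
  have hexp : Real.exp (8 * -Real.log s) = (s ^ 8)⁻¹ := by
    rw [mul_neg, Real.exp_neg, show (8 : ℝ) * Real.log s = Real.log (s ^ 8) by
      rw [Real.log_pow]; norm_num, Real.exp_log (by positivity)]
  have hp8 : hitProb v D 0 * (s ^ 8)⁻¹ ≤ s ^ 8 := by
    rw [← div_eq_mul_inv, div_le_iff₀ (by positivity)]
    linarith [show s ^ 8 * s ^ 8 = s ^ 16 by ring]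
  have hs8 : s ^ 8 ≤ s ^ 2 := pow_le_pow_of_le_one hs.le (by linarith) (by norm_num)
  have hs4 : s ^ 2 ≤ 1 / 2 := by nlinarith
  rw [hexp, Real.exp_zero] at h
  have hL := quantLoss_nonneg v x
  have h0' := hitProb_nonneg v D 0
  have hx : 1 / (8 * v) * x ^ 2 = (x ^ 2 / (2 * v)) / 4 := by ring
  have a0 := div_mul_log_le hp0 hp1 (r := s ^ 2) (by positivity)
  have a1 := div_mul_log_le (sub_nonneg.mpr hp1) (sub_le_self 1 hp0) (r := 1 - s ^ 2) (by linarith)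
  have hl : -Real.log (1 - s ^ 2) ≤ 2 * s ^ 2 := by
    have := Real.one_sub_inv_le_log_of_pos (x := 1 - s ^ 2) (by linarith)
    have h3 : (1 - s ^ 2)⁻¹ ≤ 1 + 2 * s ^ 2 := by
      rw [inv_le_iff_one_le_mul₀ (by linarith)]
      nlinarith [sq_nonneg s]
    linarith
  have hl0 : 0 ≤ -Real.log (1 - s ^ 2) := by
    linarith [Real.log_nonpos (x := 1 - s ^ 2) (by linarith) (by linarith [sq_nonneg s])]
  have a2 : (1 - hitProb v D x) * -Real.log (1 - s ^ 2) ≤ 2 * s ^ 2 := by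
    refine (mul_le_of_le_one_left hl0 (by linarith)).trans hl
  have hlog : Real.log (s ^ 2) = 2 * Real.log s := by rw [Real.log_pow]; norm_num
  rw [hlog] at a0
  rw [bernDiv_eq, hx]
  linarith

/-- A lower bound, for small `s`, on the fraction of the wideband rate `P / (2 v)` that is lost at
powers `P ≥ s`. -/
noncomputable def relLoss (s : ℝ) : ℝ := 1 / (36 + 64 * -Real.log s)

lemma relLoss_pos {s : ℝ} (hs : 0 < s) (hs1 : s ≤ 1) : 0 < relLoss s := by
  have := Real.log_nonpos hs.le hs1
  unfold relLoss
  positivity [show 0 < 36 + 64 * -Real.log s by linarith]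

lemma relLoss_le_half {s : ℝ} (hs : 0 < s) (hs1 : s ≤ 1) : relLoss s ≤ 1 / 2 := by
  have := Real.log_nonpos hs.le hs1
  exact one_div_le_one_div_of_le two_pos (by linarith)

lemma bernAC_of_mem_Ioo {p r : ℝ} (hp0 : 0 ≤ p) (hp1 : p ≤ 1) (hr0 : 0 < r) (hr1 : r < 1) :
    BernAC p r where
  nonneg := hp0
  le_one := hp1
  ac b hb := by
    cases b
    · exact absurd hb (by simp [bern]; linarith)
    · exact absurd hb (by simp [bern]; linarith)

/-- For every quantizer there is a reference output law that bounds the divergences by an affine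
function of the energy of the input with a value at `s` strictly below `s / (2 v)`. -/
lemma exists_affine_bound {v : ℝ≥0} (hv : 0 < v) {s : ℝ} (hs : 0 < s) (hs2 : s ≤ 1 / 2)
    (hsv : s ≤ 1 / (24 * v)) {D : Set ℝ} (hD : MeasurableSet D) :
    ∃ r l c : ℝ, 0 ≤ r ∧ r ≤ 1 ∧ 0 ≤ l ∧ 0 ≤ c ∧
      (∀ x, BernAC (hitProb v D x) r ∧ bernDiv (hitProb v D x) r ≤ l * x ^ 2 + c) ∧
      l * s + c ≤ s / (2 * v) * (1 - relLoss s) := by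
  have hv' : (0 : ℝ) < v := by exact_mod_cast hv
  have hhalf := relLoss_le_half hs (by linarith)
  have hlog : Real.log s ≤ 0 := Real.log_nonpos hs.le (by linarith)
  have hs4 : s ^ 2 < 1 := by nlinarith
  have hrate : 1 / (8 * v) * s + 3 * s ^ 2 ≤ s / (2 * v) * (1 - relLoss s) := by
    have h1 : 3 * s ^ 2 ≤ s / (8 * v) := by
      have := mul_le_mul_of_nonneg_left hsv (by positivity : 0 ≤ 3 * s)
      calc 3 * s ^ 2 = 3 * s * s := by ring
        _ ≤ _ := this
        _ = s / (8 * v) := by field_simp; norm_num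
    have h2 : s / (2 * v) * (1 / 2) ≤ s / (2 * v) * (1 - relLoss s) :=
      mul_le_mul_of_nonneg_left (by linarith) (by positivity)
    have h3 : 1 / (8 * v) * s + s / (8 * v) = s / (2 * v) * (1 / 2) := by field_simp; norm_num
    linarith
  have hexp : Real.exp (-(16 * -Real.log s)) = s ^ 16 := by
    rw [show -(16 * -Real.log s) = Real.log (s ^ 16) by rw [Real.log_pow]; push_cast; ring,
      Real.exp_log (by positivity)]
  by_cases h0 : s ^ 16 ≤ hitProb v D 0
  · by_cases h1 : s ^ 16 ≤ 1 - hitProb v D 0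
    · refine ⟨hitProb v D 0, (1 - relLoss s) / (2 * v), 0, hitProb_nonneg v D 0,
        hitProb_le_one v D 0, div_nonneg (by linarith) (by positivity), le_rfl, fun x => ?_,
        le_of_eq (by ring)⟩
      refine ⟨bernAC_hitProb_zero hv hD x, ?_⟩
      have := bernDiv_le_of_balanced hv hD (w := 16 * -Real.log s) (by linarith)
        (by rwa [hexp]) (by rwa [hexp]) x
      rw [add_zero]
      convert this using 4
      unfold relLoss
      congr 1
      ring
    · refine ⟨1 - s ^ 2, 1 / (8 * v), 3 * s ^ 2, by linarith, by linarith [sq_nonneg s],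
        by positivity, by positivity, fun x => ⟨bernAC_of_mem_Ioo (hitProb_nonneg v D x)
        (hitProb_le_one v D x) (by linarith) (by linarith [pow_pos hs 2]), ?_⟩, hrate⟩
      have := bernDiv_le_of_unbalanced hv hD.compl hs hs2
        (by rw [hitProb_compl v hD]; exact (not_le.mp h1).le) x
      rwa [hitProb_compl v hD, ← bernDiv_one_sub, sub_sub_cancel] at this
  · exact ⟨s ^ 2, 1 / (8 * v), 3 * s ^ 2, by positivity, hs4.le, by positivity, by positivity,
      fun x => ⟨bernAC_of_mem_Ioo (hitProb_nonneg v D x) (hitProb_le_one v D x) (by positivity) hs4,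
        bernDiv_le_of_unbalanced hv hD hs hs2 (not_le.mp h0).le x⟩, hrate⟩

lemma rate_le_of_eventually {ι : Type*} {l : Filter ι} [NeBot l] {e a N : ι → ℝ} {R B : ℝ}
    (he : Tendsto e l (𝓝 0)) (hN : Tendsto N l atTop)
    (h : ∀ᶠ i in l, (1 - e i) * a i ≤ N i * B + 1) (ha : ∀ᶠ i in l, R < a i / N i) : R ≤ B := by
  have h1 : Tendsto (fun i => (1 - e i) * R) l (𝓝 R) := by
    simpa using ((tendsto_const_nhds (x := (1 : ℝ))).sub he).mul_const R
  have h2 : Tendsto (fun i => B + (N i)⁻¹) l (𝓝 B) := by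
    simpa using tendsto_const_nhds.add (tendsto_inv_atTop_zero.comp hN)
  refine le_of_tendsto_of_tendsto h1 h2 ?_
  filter_upwards [h, ha, hN.eventually_gt_atTop 0, he.eventually_lt_const one_pos]
    with i hi hai hNi hei
  rw [lt_div_iff₀ hNi] at hai
  have h3 := mul_le_mul_of_nonneg_left hai.le (sub_nonneg.mpr hei.le)
  refine le_of_mul_le_mul_right ?_ hNi
  rw [add_mul, inv_mul_cancel₀ hNi.ne']
  linarith

/-- The converse to the coding theorem, in terms of single-letter divergence bounds. -/
lemma AchievableRate.le_of_bound {v : ℝ≥0} {P R B : ℝ} (hR : AchievableRate v P R)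
    (h : ∀ D : Set ℝ, MeasurableSet D → ∃ r l c : ℝ, 0 ≤ r ∧ r ≤ 1 ∧ 0 ≤ l ∧
      (∀ x, BernAC (hitProb v D x) r ∧ bernDiv (hitProb v D x) r ≤ l * x ^ 2 + c) ∧
      l * P + c ≤ B) : R ≤ B := by
  refine le_of_forall_pos_sub_le fun ε hε => ?_
  obtain ⟨c, hc, herr⟩ := hR ε hε
  refine rate_le_of_eventually herr tendsto_natCast_atTop_atTop ?_ (hc.mono fun n hn => hn.2)
  filter_upwards [hc, eventually_gt_atTop 0] with n hn hn0
  obtain ⟨r, l, b, hr0, hr1, hl, hx, hB⟩ := h _ (c n).measurableSet_D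
  refine (c n).log_M_le v hr0 hr1 (fun x => (hx x).1) fun m => ?_
  have hn' : (0 : ℝ) < n := by exact_mod_cast hn0
  have hE : ∑ k, (c n).enc m k ^ 2 ≤ n * P := by
    have := hn.1 m
    rwa [one_div, inv_mul_le_iff₀ hn'] at this
  calc _ ≤ ∑ k, (l * (c n).enc m k ^ 2 + b) := Finset.sum_le_sum fun k _ => (hx _).2
    _ = l * ∑ k, (c n).enc m k ^ 2 + n * b := by
      rw [Finset.sum_add_distrib, Finset.mul_sum]; simp
    _ ≤ l * (n * P) + n * b := by gcongr
    _ = n * (l * P + b) := by ring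
    _ ≤ n * B := by gcongr

lemma bernDiv_hitProb_zero_le' {v : ℝ≥0} (hv : 0 < v) {D : Set ℝ} (hD : MeasurableSet D) (x : ℝ) :
    bernDiv (hitProb v D x) (hitProb v D 0) ≤ 1 / (2 * v) * x ^ 2 := by
  have := bernDiv_hitProb_zero_le hv hD x
  have h := quantLoss_nonneg v x
  calc _ ≤ x ^ 2 / (2 * v) := by linarith
    _ = _ := by ring

lemma AchievableRate.le {v : ℝ≥0} (hv : 0 < v) {P R : ℝ} (hR : AchievableRate v P R) :
    R ≤ P / (2 * v) :=
  hR.le_of_bound fun D hD => ⟨hitProb v D 0, 1 / (2 * v), 0, hitProb_nonneg v D 0,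
    hitProb_le_one v D 0, by positivity, fun x => ⟨bernAC_hitProb_zero hv hD x, by
      simpa using bernDiv_hitProb_zero_le' hv hD x⟩, le_of_eq (by ring)⟩

/-- The converse with a loss, uniformly over the powers `P ≥ s`. -/
lemma AchievableRate.le_relLoss {v : ℝ≥0} (hv : 0 < v) {s : ℝ} (hs : 0 < s) (hs2 : s ≤ 1 / 2)
    (hsv : s ≤ 1 / (24 * v)) {P R : ℝ} (hP : s ≤ P) (hR : AchievableRate v P R) :
    R ≤ P / (2 * v) * (1 - relLoss s) := by
  refine hR.le_of_bound fun D hD => ?_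
  obtain ⟨r, l, c, hr0, hr1, hl, hc, hx, hB⟩ := exists_affine_bound hv hs hs2 hsv hD
  refine ⟨r, l, c, hr0, hr1, hl, hx, ?_⟩
  have hPs : 1 ≤ P / s := (one_le_div hs).mpr hP
  calc l * P + c = P / s * (l * s) + c := by field_simp
    _ ≤ P / s * (l * s) + P / s * c := by gcongr; exact le_mul_of_one_le_left hc hPs
    _ = P / s * (l * s + c) := by ring
    _ ≤ P / s * (s / (2 * v) * (1 - relLoss s)) :=
      mul_le_mul_of_nonneg_left hB (zero_le_one.trans hPs)
    _ = _ := by field_simp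

lemma AchievableRatePerEnergy.le {v : ℝ≥0} (hv : 0 < v) {R : ℝ}
    (hR : AchievableRatePerEnergy v R) : R ≤ 1 / (2 * v) := by
  refine le_of_forall_pos_sub_le fun ε hε => ?_
  obtain ⟨n, c, hc, herr⟩ := hR ε hε
  refine rate_le_of_eventually herr tendsto_id ?_ (hc.mono fun E hE => hE.2)
  filter_upwards [hc] with E hE
  refine (c E).log_M_le v (hitProb_nonneg v _ 0) (hitProb_le_one v _ 0)
    (fun x => bernAC_hitProb_zero hv (c E).measurableSet_D x) fun m => ?_
  calc _ ≤ ∑ k, 1 / (2 * v) * (c E).enc m k ^ 2 :=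
        Finset.sum_le_sum fun k _ => bernDiv_hitProb_zero_le' hv (c E).measurableSet_D _
    _ = 1 / (2 * v) * ∑ k, (c E).enc m k ^ 2 := by rw [Finset.mul_sum]
    _ ≤ 1 / (2 * v) * E := by gcongr; exact hE.1 m
    _ = id E * (1 / (2 * v)) := mul_comm _ _

/-- The code that has a single message and sends it with zero energy. -/
def Code.trivial (n : ℕ) : Code n where
  M := 1
  enc _ _ := 0
  D := ∅
  measurableSet_D := MeasurableSet.empty
  dec _ := 0

lemma Code.errorProb_trivial (n : ℕ) (v : ℝ≥0) : (Code.trivial n).errorProb v = 0 := by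
  have h : ∀ m, (Code.trivial n).errorProbOf v m = 0 := by
    intro m
    have : {z : Fin n → ℝ | (Code.trivial n).dec
        (fun k => quantize (Code.trivial n).D ((Code.trivial n).enc m k + z k)) ≠ m} = ∅ := by
      ext z
      simp only [mem_ofPred_eq, mem_empty_iff_false, iff_false, not_not]
      exact Subsingleton.elim (α := Fin 1) _ _
    rw [Code.errorProbOf, this, measureReal_empty]
  rw [Code.errorProb, Finset.sum_eq_zero fun m _ => h m, zero_div]

lemma achievableRate_zero (v : ℝ≥0) {P : ℝ} (hP : 0 < P) : AchievableRate v P 0 := by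
  refine fun ε hε => ⟨Code.trivial, Eventually.of_forall fun n => ⟨fun m => ?_, ?_⟩, ?_⟩
  · simpa [Code.trivial] using hP.le
  · simpa [Code.trivial] using hε
  · simp [Code.errorProb_trivial]

lemma achievableRatePerEnergy_zero (v : ℝ≥0) : AchievableRatePerEnergy v 0 := by
  refine fun ε hε => ⟨fun _ => 0, fun _ => Code.trivial 0, ?_, ?_⟩
  · filter_upwards [eventually_ge_atTop 0] with E hE
    exact ⟨fun m => by simpa using hE, by simpa [Code.trivial] using hε⟩
  · simp [Code.errorProb_trivial]

lemma isLUB_capacity {v : ℝ≥0} (hv : 0 < v) {P : ℝ} (hP : 0 < P) :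
    IsLUB {R | AchievableRate v P R} (capacity v P) :=
  isLUB_csSup ⟨0, achievableRate_zero v hP⟩ ⟨P / (2 * v), fun _ hR => AchievableRate.le hv hR⟩

lemma isLUB_capacityPerEnergy {v : ℝ≥0} (hv : 0 < v) :
    IsLUB {R | AchievableRatePerEnergy v R} (capacityPerEnergy v) :=
  isLUB_csSup ⟨0, achievableRatePerEnergy_zero v⟩
    ⟨1 / (2 * v), fun _ hR => AchievableRatePerEnergy.le hv hR⟩

lemma capacity_le_relLoss {v : ℝ≥0} (hv : 0 < v) {s : ℝ} (hs : 0 < s) (hs2 : s ≤ 1 / 2)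
    (hsv : s ≤ 1 / (24 * v)) {P : ℝ} (hP : s ≤ P) :
    capacity v P ≤ P / (2 * v) * (1 - relLoss s) :=
  (isLUB_capacity hv (hs.trans_le hP)).2 fun _ hR => AchievableRate.le_relLoss hv hs hs2 hsv hP hR

/-! ### Block codes from pulse-position words -/

lemma card_hammingBall_le {L q : ℕ} (hq : 0 < q) (t : ℕ) (x : Fin L → Fin q) :
    Finset.card {y : Fin L → Fin q | hammingDist x y ≤ t} ≤ 2 ^ L * q ^ t := by
  classical
  have hq' : (0 : ℝ) < q := by exact_mod_cast hq
  have hq1 : (q : ℝ)⁻¹ ≤ 1 := inv_le_one_of_one_le₀ (by exact_mod_cast hq)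
  -- The generating function of the distance to `x`, evaluated at `1 / q`.
  have hgen : ∑ y : Fin L → Fin q, ((q : ℝ)⁻¹) ^ hammingDist x y ≤ 2 ^ L := by
    have h : ∀ y : Fin L → Fin q, ((q : ℝ)⁻¹) ^ hammingDist x y
        = ∏ j, (if x j ≠ y j then (q : ℝ)⁻¹ else 1) := by
      intro y
      rw [Finset.prod_ite, Finset.prod_const, Finset.prod_const_one, mul_one]
      rfl
    simp_rw [h]
    rw [← Fintype.prod_sum (fun j b => if x j ≠ b then (q : ℝ)⁻¹ else 1)]
    calc _ ≤ ∏ _j : Fin L, (2 : ℝ) := by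
          refine Finset.prod_le_prod (fun j _ => Finset.sum_nonneg fun b _ => by
            split_ifs <;> positivity) fun j _ => ?_
          calc _ ≤ ∑ b : Fin q, ((q : ℝ)⁻¹ + if x j = b then 1 else 0) := by
                refine Finset.sum_le_sum fun b _ => ?_
                by_cases hb : x j = b <;> simp [hb]
            _ = 2 := by
                rw [Finset.sum_add_distrib]
                simp [hq'.ne']
                norm_num
      _ = 2 ^ L := by simp
  have hball : (Finset.card {y : Fin L → Fin q | hammingDist x y ≤ t} : ℝ) * ((q : ℝ)⁻¹) ^ t
      ≤ 2 ^ L := by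
    refine le_trans ?_ hgen
    calc _ = ∑ y with hammingDist x y ≤ t, ((q : ℝ)⁻¹) ^ t := by simp
      _ ≤ ∑ y with hammingDist x y ≤ t, ((q : ℝ)⁻¹) ^ hammingDist x y :=
          Finset.sum_le_sum fun y hy =>
            pow_le_pow_of_le_one (by positivity) hq1 (Finset.mem_filter.mp hy).2
      _ ≤ _ := Finset.sum_le_sum_of_subset_of_nonneg (Finset.filter_subset _ _)
          fun _ _ _ => by positivity
  rw [inv_pow, ← div_eq_mul_inv, div_le_iff₀ (by positivity)] at hball
  exact_mod_cast hball

/-- The Gilbert–Varshamov bound, with a crude estimate of the volume of Hamming balls. -/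
lemma exists_separated {L q : ℕ} (hq : 0 < q) (t : ℕ) :
    ∃ S : Finset (Fin L → Fin q), (∀ s ∈ S, ∀ s' ∈ S, s ≠ s' → t < hammingDist s s') ∧
      q ^ L ≤ S.card * (2 ^ L * q ^ t) := by
  classical
  -- The balls around a separated set of maximal size cover everything.
  obtain ⟨S, hS, hmax⟩ := Finset.exists_max_image
    (Finset.univ.filter fun S : Finset (Fin L → Fin q) =>
      ∀ s ∈ S, ∀ s' ∈ S, s ≠ s' → t < hammingDist s s') Finset.card ⟨∅, by simp⟩
  rw [Finset.mem_filter] at hS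
  refine ⟨S, hS.2, ?_⟩
  have hcover : (Finset.univ : Finset (Fin L → Fin q))
      ⊆ S.biUnion fun s => Finset.univ.filter fun y => hammingDist s y ≤ t := by
    intro y _
    by_contra hy
    simp only [Finset.mem_biUnion, Finset.mem_filter, Finset.mem_univ, true_and, not_exists,
      not_and, not_le] at hy
    have hyS : y ∉ S := fun h => by simpa using hy y h
    have := hmax (insert y S) (by
      refine Finset.mem_filter.mpr ⟨Finset.mem_univ _, fun s hs s' hs' hne => ?_⟩
      rcases Finset.mem_insert.mp hs with rfl | h1 <;> rcases Finset.mem_insert.mp hs' with rfl | h2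
      · exact absurd rfl hne
      · rw [hammingDist_comm]; exact hy s' h2
      · exact hy s h1
      · exact hS.2 s h1 s' h2 hne)
    rw [Finset.card_insert_of_notMem hyS] at this
    omega
  calc q ^ L = (Finset.univ : Finset (Fin L → Fin q)).card := by simp
    _ ≤ _ := Finset.card_le_card hcover
    _ ≤ _ := Finset.card_biUnion_le_card_mul _ _ _ fun s _ => card_hammingBall_le hq t s

open Classical in
/-- The binary word of length `n` that encodes a word `s` of length `L` over an alphabet of `q`
letters by pulse positions: the word is cut into blocks of length `q`, and the `j`-th block has a
single `true`, at position `s j`. The word is padded with `false`. -/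
noncomputable def pulseWord (n : ℕ) {L q : ℕ} (s : Fin L → Fin q) (k : Fin n) : Bool :=
  decide (∃ h : k.1 / q < L, (s ⟨k.1 / q, h⟩).1 = k.1 % q)

lemma card_pulseWord_le (n : ℕ) {L q : ℕ} (s : Fin L → Fin q) :
    Finset.card {k | pulseWord n s k = true} ≤ L := by
  classical
  by_cases hL : L = 0
  · subst hL; simp [pulseWord]
  have : NeZero L := ⟨hL⟩
  refine (Finset.card_le_card_of_injOn (t := (Finset.univ : Finset (Fin L)))
    (fun k => Fin.ofNat L (k.1 / q)) (by simp) ?_).trans (by simp)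
  intro k hk k' hk' h
  simp only [pulseWord, decide_eq_true_eq, Finset.coe_filter, Finset.mem_univ, true_and,
    mem_ofPred_eq] at hk hk'
  obtain ⟨h1, h2⟩ := hk
  obtain ⟨h1', h2'⟩ := hk'
  simp only [Fin.ofNat, Fin.mk.injEq, Nat.mod_eq_of_lt h1, Nat.mod_eq_of_lt h1'] at h
  have h3 : k.1 % q = k'.1 % q := by
    rw [← h2, ← h2']; congr 2; exact Fin.ext h
  exact Fin.ext (by rw [← Nat.div_add_mod k.1 q, ← Nat.div_add_mod k'.1 q, h, h3])

lemma hammingDist_le_hammingDist_pulseWord {n L q : ℕ} (hn : L * q ≤ n) (s s' : Fin L → Fin q) :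
    hammingDist s s' ≤ hammingDist (pulseWord n s) (pulseWord n s') := by
  classical
  have hlt : ∀ j : Fin L, j.1 * q + (s j).1 < n := fun j => by
    have h1 : (j.1 + 1) * q ≤ L * q := Nat.mul_le_mul_right q j.2
    have h2 := (s j).2
    linarith [add_mul j.1 1 q]
  have hdiv : ∀ j : Fin L, (j.1 * q + (s j).1) / q = j.1 := fun j => by
    rw [add_comm, Nat.add_mul_div_right _ _ ((Nat.zero_le _).trans_lt (s j).2),
      Nat.div_eq_of_lt (s j).2, zero_add]
  have hmod : ∀ j : Fin L, (j.1 * q + (s j).1) % q = (s j).1 := fun j => by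
    rw [add_comm, Nat.add_mul_mod_self_right, Nat.mod_eq_of_lt (s j).2]
  refine Finset.card_le_card_of_injOn (fun j => ⟨j.1 * q + (s j).1, hlt j⟩) ?_ ?_
  · intro j hj
    simp only [Finset.coe_filter, Finset.mem_univ, true_and, mem_ofPred_eq] at hj ⊢
    have h1 : pulseWord n s ⟨j.1 * q + (s j).1, hlt j⟩ = true := by
      simp [pulseWord, hdiv, hmod]
    have h2 : pulseWord n s' ⟨j.1 * q + (s j).1, hlt j⟩ = false := by
      simp only [pulseWord, hdiv, hmod, decide_eq_false_iff_not, not_exists]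
      exact fun _ h => hj (Fin.ext h.symm)
    rw [h1, h2]; simp
  · intro j _ j' _ h
    simp only [Fin.mk.injEq] at h
    exact Fin.ext (by rw [← hdiv j, ← hdiv j', h])

open Classical in
/-- The code that sends binary words by on-off signalling with amplitude `A`, decoded to a word
within Hamming distance `t` of the quantizer outputs if there is one. -/
noncomputable def Code.onOff {n M : ℕ} (hM : 0 < M) (w : Fin M → Fin n → Bool) (A : ℝ)
    {D : Set ℝ} (hD : MeasurableSet D) (t : ℕ) : Code n where
  M := M
  enc m k := if w m k then A else 0
  D := D
  measurableSet_D := hD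
  dec y := if h : ∃ m, hammingDist (w m) y ≤ t then h.choose else ⟨0, hM⟩

/-- The probability that a received word is at distance at least `t` from the transmitted one,
by an exponential Markov inequality. -/
lemma sum_prod_bern_far_le {n : ℕ} {p : Fin n → ℝ} (h0 : ∀ k, 0 ≤ p k) (h1 : ∀ k, p k ≤ 1)
    (w : Fin n → Bool) (t : ℕ) :
    ∑ y with t ≤ hammingDist w y, ∏ k, bern (p k) (y k)
      ≤ Real.exp (2 * ∑ k, bern (p k) (!w k) - t) := by
  classical
  have hexp : ∀ y : Fin n → Bool, Real.exp (hammingDist w y)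
      = ∏ k, (if w k ≠ y k then Real.exp 1 else 1) := by
    intro y
    rw [Finset.prod_ite, Finset.prod_const, Finset.prod_const_one, mul_one, ← Real.exp_nat_mul,
      mul_one]
    rfl
  calc _ ≤ ∑ y with t ≤ hammingDist w y,
          (∏ k, bern (p k) (y k)) * (Real.exp (hammingDist w y) * Real.exp (-t)) := by
        refine Finset.sum_le_sum fun y hy => le_mul_of_one_le_right (prod_bern_nonneg h0 h1 y) ?_
        rw [← Real.exp_add]
        have : (t : ℝ) ≤ hammingDist w y := by exact_mod_cast (Finset.mem_filter.mp hy).2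
        exact Real.one_le_exp (by linarith)
    _ ≤ ∑ y : Fin n → Bool,
          (∏ k, bern (p k) (y k)) * (Real.exp (hammingDist w y) * Real.exp (-t)) :=
        Finset.sum_le_sum_of_subset_of_nonneg (Finset.filter_subset _ _) fun y _ _ =>
          mul_nonneg (prod_bern_nonneg h0 h1 y) (by positivity)
    _ = (∏ k, ∑ b, bern (p k) b * (if w k ≠ b then Real.exp 1 else 1)) * Real.exp (-t) := by
        rw [← sum_prod_word (fun k b => bern (p k) b * (if w k ≠ b then Real.exp 1 else 1)),
          Finset.sum_mul]
        refine Finset.sum_congr rfl fun y _ => ?_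
        rw [hexp, Finset.prod_mul_distrib, mul_assoc]
    _ ≤ (∏ k, Real.exp (2 * bern (p k) (!w k))) * Real.exp (-t) := by
        refine mul_le_mul_of_nonneg_right (Finset.prod_le_prod (fun k _ =>
          Finset.sum_nonneg fun b _ => mul_nonneg (bern_nonneg (h0 k) (h1 k) b)
            (by split_ifs <;> positivity)) fun k _ => ?_) (Real.exp_pos _).le
        have he : Real.exp 1 ≤ 3 := Real.exp_one_lt_three.le
        have hb := bern_nonneg (h0 k) (h1 k) (!w k)
        have h2 : ∑ b, bern (p k) b * (if w k ≠ b then Real.exp 1 else 1)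
            = 1 + bern (p k) (!w k) * (Real.exp 1 - 1) := by
          cases w k <;> simp [bern] <;> ring
        rw [h2]
        refine le_trans ?_ (Real.add_one_le_exp _)
        nlinarith
    _ = _ := by
        rw [← Real.exp_sum, ← Real.exp_add, ← Finset.mul_sum, ← sub_eq_add_neg]

lemma Code.errorProb_onOff_le {v : ℝ≥0} {n M W : ℕ} (hM : 0 < M) (w : Fin M → Fin n → Bool)
    (A : ℝ) {D : Set ℝ} (hD : MeasurableSet D) (t : ℕ)
    (hW : ∀ m, Finset.card {k | w m k = true} ≤ W)
    (hsep : ∀ m m', m ≠ m' → 2 * t < hammingDist (w m) (w m')) :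
    (Code.onOff hM w A hD t).errorProb v
      ≤ Real.exp (2 * (W * (1 - hitProb v D A) + n * hitProb v D 0) - t) := by
  classical
  set c := Code.onOff hM w A hD t with hc
  have hm : ∀ m : Fin c.M, c.errorProbOf v m
      ≤ Real.exp (2 * (W * (1 - hitProb v D A) + n * hitProb v D 0) - t) := by
    intro m
    set p : Fin n → ℝ := fun k => hitProb v c.D (c.enc m k) with hp
    rw [c.errorProbOf_eq]
    refine (Finset.sum_le_sum_of_subset_of_nonneg (t := Finset.univ.filter
      fun y => t ≤ hammingDist (w m) y) ?_ fun y _ _ => prod_bern_nonneg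
        (fun _ => hitProb_nonneg _ _ _) (fun _ => hitProb_le_one _ _ _) y).trans
      ((sum_prod_bern_far_le (fun _ => hitProb_nonneg _ _ _) (fun _ => hitProb_le_one _ _ _)
        (w m) t).trans ?_)
    · intro y hy
      simp only [Finset.mem_filter, Finset.mem_univ, true_and] at hy ⊢
      by_contra hlt
      push Not at hlt
      have hex : ∃ m, hammingDist (w m) y ≤ t := ⟨m, hlt.le⟩
      have hdec : c.dec y = hex.choose := dif_pos hex
      have h1 := hsep _ _ (hdec ▸ hy)
      have h2 := hex.choose_spec
      have h3 := hammingDist_triangle (w hex.choose) y (w m)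
      rw [hammingDist_comm y (w m)] at h3
      omega
    · have hk : ∀ k, bern (hitProb v c.D (c.enc m k)) (!w m k)
          ≤ (if w m k = true then 1 - hitProb v D A else 0) + hitProb v D 0 := by
        intro k
        have h0 := hitProb_nonneg v D 0
        have henc : c.enc m k = if w m k then A else 0 := rfl
        have hcD : c.D = D := rfl
        rw [henc, hcD]
        cases w m k <;> simp [bern, h0]
      have hsum := Finset.sum_le_sum fun k (_ : k ∈ Finset.univ) => hk k
      rw [Finset.sum_add_distrib, ← Finset.sum_filter] at hsum
      simp only [Finset.sum_const, Finset.card_univ, Fintype.card_fin, nsmul_eq_mul] at hsum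
      have hWm : (Finset.card {k | w m k = true} : ℝ) ≤ W := by exact_mod_cast hW m
      have := mul_le_mul_of_nonneg_right hWm (sub_nonneg.mpr (hitProb_le_one v D A))
      refine Real.exp_le_exp.mpr ?_
      linarith
  have hM' : (0 : ℝ) < c.M := by exact_mod_cast hM
  rw [Code.errorProb, div_le_iff₀ hM']
  refine (Finset.sum_le_sum fun m _ => hm m).trans (le_of_eq ?_)
  simp [mul_comm]

/-- For every block length a Gilbert–Varshamov code over the alphabet of pulse positions gives a
code whose energy, size and error probability are controlled by the number `n / q` of blocks. -/
lemma exists_pulse_code (v : ℝ≥0) {q : ℕ} (hq : 0 < q) (A : ℝ) {D : Set ℝ} (hD : MeasurableSet D)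
    {δ : ℝ} (hδ : 0 ≤ δ) (n : ℕ) :
    ∃ c : Code n, (∀ m, ∑ k, c.enc m k ^ 2 ≤ (n / q : ℕ) * A ^ 2) ∧
      (n / q : ℕ) * ((1 - 2 * δ) * Real.log q - Real.log 2) ≤ Real.log c.M ∧
      c.errorProb v ≤ Real.exp (2 * ((n / q : ℕ) * (1 - hitProb v D A) + n * hitProb v D 0)
        - (δ * (n / q : ℕ) - 1)) := by
  classical
  set L := n / q with hL
  set t := ⌊δ * L⌋₊ with ht
  have hq' : (1 : ℝ) ≤ q := by exact_mod_cast hq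
  have ht1 : (t : ℝ) ≤ δ * L := Nat.floor_le (by positivity)
  have ht2 : δ * L - 1 ≤ t := (Nat.sub_one_lt_floor _).le
  -- Distance more than `2 * t` makes decoding to within distance `t` unambiguous.
  obtain ⟨S, hsep, hcard⟩ := exists_separated (L := L) hq (2 * t)
  have hM : 0 < S.card := by
    rcases Nat.eq_zero_or_pos S.card with h | h
    · rw [h, zero_mul] at hcard
      exact absurd hcard (not_le.mpr (by positivity))
    · exact h
  set e := S.equivFin.symm with he
  set w : Fin S.card → Fin n → Bool := fun m => pulseWord n (e m).1 with hw
  have hW : ∀ m, Finset.card {k | w m k = true} ≤ L := fun m => card_pulseWord_le n _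
  refine ⟨Code.onOff hM w A hD t, fun m => ?_, ?_, ?_⟩
  · have henc : ∀ k, (Code.onOff hM w A hD t).enc m k ^ 2 = if w m k = true then A ^ 2 else 0 := by
      intro k
      have : (Code.onOff hM w A hD t).enc m k = if w m k then A else 0 := rfl
      rw [this]; split_ifs <;> simp
    simp_rw [henc]
    rw [← Finset.sum_filter, Finset.sum_const, nsmul_eq_mul]
    gcongr
    exact hW m
  · have hMc : (Code.onOff hM w A hD t).M = S.card := rfl
    rw [hMc]
    have hcard' : (q : ℝ) ^ L ≤ S.card * (2 ^ L * q ^ (2 * t)) := by exact_mod_cast hcard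
    have hlog := Real.log_le_log (by positivity) hcard'
    have hM' : (0 : ℝ) < S.card := by exact_mod_cast hM
    rw [Real.log_mul (by positivity) (by positivity), Real.log_mul (by positivity) (by positivity),
      Real.log_pow, Real.log_pow, Real.log_pow] at hlog
    push_cast at hlog
    have := mul_le_mul_of_nonneg_right ht1 (Real.log_nonneg hq')
    linarith
  · refine (Code.errorProb_onOff_le hM w A hD t hW fun m m' hmm' => ?_).trans
      (Real.exp_le_exp.mpr (by linarith))
    refine (hsep _ (e m).2 _ (e m').2 fun h => hmm' ?_).trans_le
      (hammingDist_le_hammingDist_pulseWord (Nat.div_mul_le_self n q) _ _)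
    exact e.injective (Subtype.ext h)

/-- On-off signalling with pulse positions in blocks of length `q`: if the two error
probabilities of the quantizer are small enough, then pulse positions can be sent reliably. -/
lemma achievableRate_pulse (v : ℝ≥0) {q : ℕ} (hq : 0 < q) (A : ℝ) {D : Set ℝ}
    (hD : MeasurableSet D) {δ : ℝ} (hδ : 0 < δ)
    (herr : (1 - hitProb v D A) + 2 * (q * hitProb v D 0) ≤ δ / 4)
    (hρ : 0 ≤ (1 - 2 * δ) * Real.log q - Real.log 2) :
    AchievableRate v (A ^ 2 / q) (((1 - 2 * δ) * Real.log q - Real.log 2) / q) := by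
  intro ε hε
  set ρ := (1 - 2 * δ) * Real.log q - Real.log 2 with hρdef
  have hq' : (0 : ℝ) < q := by exact_mod_cast hq
  choose c hE hR he using exists_pulse_code v hq A hD hδ.le
  have hdiv : ∀ n : ℕ, ((n / q : ℕ) : ℝ) * q ≤ n := fun n => by
    exact_mod_cast Nat.div_mul_le_self n q
  have hdiv' : ∀ n : ℕ, (n : ℝ) ≤ ((n / q : ℕ) + 1) * q := fun n => by
    exact_mod_cast (Nat.lt_div_mul_add hq (a := n)).le.trans (by rw [add_mul, one_mul])
  have hLtop : Tendsto (fun n : ℕ => n / q) atTop atTop := Nat.tendsto_div_const_atTop hq.ne'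
  refine ⟨c, ?_, ?_⟩
  · have hlim : Tendsto (fun n : ℕ => ρ / n) atTop (𝓝 0) := tendsto_const_div_atTop_nhds_zero_nat ρ
    filter_upwards [eventually_gt_atTop 0, hlim.eventually_lt_const hε] with n hn hnε
    have hn' : (0 : ℝ) < n := by exact_mod_cast hn
    refine ⟨fun m => ?_, ?_⟩
    · rw [one_div, inv_mul_le_iff₀ hn', mul_div_assoc', le_div_iff₀ hq']
      have := mul_le_mul_of_nonneg_right (hE n m) hq'.le
      have h2 := mul_le_mul_of_nonneg_right (hdiv n) (sq_nonneg A)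
      linarith
    · have h1 : ρ / q - ρ / n ≤ (n / q : ℕ) * ρ / n := by
        rw [div_sub_div _ _ hq'.ne' hn'.ne', div_le_div_iff₀ (by positivity) hn']
        have := mul_le_mul_of_nonneg_left (hdiv' n) (by positivity : 0 ≤ ρ * n)
        linarith
      have h2 := div_le_div_of_nonneg_right (hR n) hn'.le
      linarith
  · refine squeeze_zero' (Eventually.of_forall fun n => (c n).errorProb_nonneg v)
      (g := fun n : ℕ => Real.exp (1 - δ / 2 * (n / q : ℕ))) ?_ ?_
    · filter_upwards [hLtop.eventually_ge_atTop 1] with n hn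
      have hL1 : (1 : ℝ) ≤ (n / q : ℕ) := by exact_mod_cast hn
      refine (he n).trans (Real.exp_le_exp.mpr ?_)
      have h0 := hitProb_nonneg v D 0
      have h1 : n * hitProb v D 0 ≤ (n / q : ℕ) * (2 * (q * hitProb v D 0)) := by
        have := mul_le_mul_of_nonneg_right (hdiv' n) h0
        have h2 := mul_le_mul_of_nonneg_right hL1 (mul_nonneg hq'.le h0)
        linarith
      have h2 := mul_le_mul_of_nonneg_left herr (by positivity : (0 : ℝ) ≤ (n / q : ℕ))
      linarith
    · refine Real.tendsto_exp_atBot.comp ?_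
      have h1 : Tendsto (fun n : ℕ => δ / 2 * ((n / q : ℕ) : ℝ)) atTop atTop :=
        (tendsto_natCast_atTop_atTop.comp hLtop).const_mul_atTop (by positivity)
      exact tendsto_atBot_add_const_left _ 1 (tendsto_neg_atTop_atBot.comp h1)

lemma hitProb_Ici_le {v : ℝ≥0} (hv : 0 < v) {x T : ℝ} (h : x ≤ T) :
    hitProb v (Ici T) x ≤ Real.exp (-((T - x) ^ 2 / (2 * v))) := by
  have hv' : (0 : ℝ) < v := by exact_mod_cast hv
  have := measure_ge_le_exp_mul_mgf (μ := gaussianReal x v) (X := id) (t := (T - x) / v) T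
    (div_nonneg (by linarith) hv'.le) (integrable_exp_mul_gaussianReal _)
  rw [mgf_id_gaussianReal, ← Real.exp_add] at this
  refine this.trans (le_of_eq ?_)
  congr 1; field_simp; ring

lemma one_sub_hitProb_Ici_le {v : ℝ≥0} (hv : 0 < v) {x T : ℝ} (h : T ≤ x) :
    1 - hitProb v (Ici T) x ≤ Real.exp (-((x - T) ^ 2 / (2 * v))) := by
  have hv' : (0 : ℝ) < v := by exact_mod_cast hv
  have := measure_le_le_exp_mul_mgf (μ := gaussianReal x v) (X := id) (t := (T - x) / v) T
    (div_nonpos_of_nonpos_of_nonneg (by linarith) hv'.le) (integrable_exp_mul_gaussianReal _)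
  rw [mgf_id_gaussianReal, ← Real.exp_add] at this
  rw [← hitProb_compl v measurableSet_Ici, compl_Ici]
  refine (measureReal_mono (μ := gaussianReal x v) (s₂ := {y | id y ≤ T}) (fun y hy => ?_)).trans
    (this.trans (le_of_eq ?_))
  · exact (mem_Iio.mp hy).le
  · congr 1; field_simp; ring

/-- At suitable arbitrarily small powers the capacity is close to `P / (2 v)`. -/
lemma exists_capacity_ge {v : ℝ≥0} (hv : 0 < v) {κ : ℝ} (hκ : κ < 1) {P₁ : ℝ} (hP₁ : 0 < P₁) :
    ∃ P, 0 < P ∧ P ≤ P₁ ∧ κ * (P / (2 * v)) ≤ capacity v P := by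
  have hv' : (0 : ℝ) < v := by exact_mod_cast hv
  -- `a` is the energy of a pulse divided by `2 v`; the threshold of the quantizer is `1 - δ` times
  -- the amplitude, and the pulse occupies one out of `q ≈ exp ((1 - δ) ^ 3 a)` positions.
  obtain ⟨δ, hδ0, hδ⟩ : ∃ δ : ℝ, 0 < δ ∧ δ ≤ min ((1 - κ) / 6) (1 / 12) :=
    ⟨min ((1 - κ) / 6) (1 / 12), by simp; linarith, le_rfl⟩
  have hδκ : κ ≤ 1 - 6 * δ := by linarith [hδ.trans (min_le_left _ _)]
  have hδ1 : δ ≤ 1 / 12 := hδ.trans (min_le_right _ _)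
  set η := (1 - δ) ^ 3 with hη
  have hη0 : 0 < η := pow_pos (by linarith) 3
  have hlin : ∀ c : ℝ, 0 < c → Tendsto (fun a : ℝ => Real.exp (-(c * a))) atTop (𝓝 0) :=
    fun c hc => Real.tendsto_exp_atBot.comp
      (tendsto_neg_atTop_atBot.comp (tendsto_id.const_mul_atTop hc))
  have hE1 : Tendsto (fun a : ℝ => Real.exp (-(δ ^ 2 * a))
      + 4 * Real.exp (-((1 - δ) ^ 2 * δ * a))) atTop (𝓝 0) := by
    have h1δ : 0 < 1 - δ := by linarith
    simpa using (hlin _ (by positivity)).add ((hlin ((1 - δ) ^ 2 * δ) (by positivity)).const_mul 4)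
  have hE2 : Tendsto (fun a : ℝ => 2 * v / η * ((η * a) * Real.exp (-(η * a)))) atTop (𝓝 0) := by
    have := (Real.tendsto_pow_mul_exp_neg_atTop_nhds_zero 1).comp
      (tendsto_id.const_mul_atTop hη0)
    simpa using this.const_mul (2 * v / η)
  obtain ⟨a, ha1, ha2, ha3, ha4⟩ := (((hE1.eventually_lt_const (by positivity : 0 < δ / 4)).and
    ((hE2.eventually_lt_const hP₁).and ((eventually_gt_atTop 0).and
      (eventually_ge_atTop (Real.log 2 / δ))))).exists)
  set q := ⌈Real.exp (η * a)⌉₊ with hq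
  have hexp1 : 1 ≤ Real.exp (η * a) := Real.one_le_exp (by positivity)
  have hq1 : Real.exp (η * a) ≤ q := Nat.le_ceil _
  have hq2 : (q : ℝ) ≤ 2 * Real.exp (η * a) := by
    linarith [Nat.ceil_lt_add_one (Real.exp_pos (η * a)).le]
  have hq0 : (0 : ℝ) < q := (Real.exp_pos _).trans_le hq1
  have hlogq : η * a ≤ Real.log q := (Real.le_log_iff_exp_le hq0).mpr hq1
  set A := √(2 * v * a) with hA
  have hA0 : 0 ≤ A := Real.sqrt_nonneg _
  have hA2 : A ^ 2 = 2 * v * a := Real.sq_sqrt (by positivity)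
  set T := (1 - δ) * A with hT
  have hmiss : 1 - hitProb v (Ici T) A ≤ Real.exp (-(δ ^ 2 * a)) := by
    refine (one_sub_hitProb_Ici_le hv (by rw [hT]; nlinarith)).trans (le_of_eq ?_)
    rw [show (A - T) ^ 2 = δ ^ 2 * A ^ 2 by rw [hT]; ring, hA2]
    congr 2; field_simp
  have hfalse : q * hitProb v (Ici T) 0 ≤ 2 * Real.exp (-((1 - δ) ^ 2 * δ * a)) := by
    have h1 : hitProb v (Ici T) 0 ≤ Real.exp (-((1 - δ) ^ 2 * a)) := by
      refine (hitProb_Ici_le hv (by rw [hT]; nlinarith)).trans (le_of_eq ?_)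
      rw [show (T - 0) ^ 2 = (1 - δ) ^ 2 * A ^ 2 by rw [hT]; ring, hA2]
      congr 2; field_simp
    calc q * hitProb v (Ici T) 0
        ≤ 2 * Real.exp (η * a) * Real.exp (-((1 - δ) ^ 2 * a)) := by
          exact mul_le_mul hq2 h1 (hitProb_nonneg v _ 0) (by positivity)
      _ = _ := by
          rw [mul_assoc, ← Real.exp_add]
          congr 2; rw [hη]; ring
  have hη3 : 1 - 3 * δ ≤ η := by
    rw [hη]; nlinarith [sq_nonneg δ, pow_pos hδ0 2, mul_nonneg (sq_nonneg δ) hδ0.le]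
  have hlog2 : Real.log 2 ≤ δ * a := by
    rwa [div_le_iff₀ hδ0, mul_comm] at ha4
  have hρ : (1 - 6 * δ) * a ≤ (1 - 2 * δ) * Real.log q - Real.log 2 := by
    have h1 : (1 - 2 * δ) * ((1 - 3 * δ) * a) ≤ (1 - 2 * δ) * Real.log q := by
      refine mul_le_mul_of_nonneg_left (le_trans ?_ hlogq) (by linarith)
      gcongr
    nlinarith [mul_nonneg (sq_nonneg δ) ha3.le]
  have hach := achievableRate_pulse v (q := q) (by exact_mod_cast hq0) A
    (measurableSet_Ici (a := T)) hδ0 (by linarith)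
    ((mul_nonneg (by linarith) ha3.le).trans hρ)
  have hP0 : 0 < A ^ 2 / q := by rw [hA2]; positivity
  refine ⟨A ^ 2 / q, hP0, ?_, le_trans ?_ ((isLUB_capacity hv hP0).1 hach)⟩
  · refine le_trans ?_ ha2.le
    calc A ^ 2 / q ≤ 2 * v * a / Real.exp (η * a) := by rw [hA2]; gcongr
      _ = _ := by rw [Real.exp_neg]; field_simp
  · rw [hA2]
    have : κ * (2 * v * a / q / (2 * v)) = κ * a / q := by field_simp
    rw [this]
    refine div_le_div_of_nonneg_right (le_trans ?_ hρ) hq0.le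
    gcongr

/-! ### The behaviour of the capacity at small power -/

lemma AchievableRate.mono {v : ℝ≥0} {P P' R : ℝ} (h : P ≤ P') (hR : AchievableRate v P R) :
    AchievableRate v P' R := fun ε hε => by
  obtain ⟨c, hc, he⟩ := hR ε hε
  exact ⟨c, hc.mono fun n hn => ⟨fun m => (hn.1 m).trans h, hn.2⟩, he⟩

lemma capacity_mono {v : ℝ≥0} (hv : 0 < v) {P P' : ℝ} (hP : 0 < P) (h : P ≤ P') :
    capacity v P ≤ capacity v P' :=
  (isLUB_capacity hv hP).2 fun _ hR => (isLUB_capacity hv (hP.trans_le h)).1 (hR.mono h)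

lemma capacity_pos {v : ℝ≥0} (hv : 0 < v) {P : ℝ} (hP : 0 < P) : 0 < capacity v P := by
  obtain ⟨P', hP', hle, h⟩ := exists_capacity_ge hv (κ := 1 / 2) (by norm_num) hP
  have hv' : (0 : ℝ) < v := by exact_mod_cast hv
  exact lt_of_lt_of_le (by positivity) (h.trans (capacity_mono hv hP' hle))

/-- A rate that is achievable with power `P` uses `P` units of energy for each channel use. -/
lemma AchievableRate.perEnergy {v : ℝ≥0} {P R : ℝ} (hP : 0 < P) (hR : AchievableRate v P R) :
    AchievableRatePerEnergy v (R / P) := by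
  intro ε hε
  obtain ⟨c, hc, he⟩ := hR (P * ε / 2) (by positivity)
  have hn : Tendsto (fun E : ℝ => ⌊P⁻¹ * E⌋₊) atTop atTop :=
    tendsto_nat_floor_atTop.comp (tendsto_id.const_mul_atTop (inv_pos.mpr hP))
  have hlim : Tendsto (fun E : ℝ => (⌊P⁻¹ * E⌋₊ : ℝ) / E * (R - P * ε / 2)) atTop
      (𝓝 (P⁻¹ * (R - P * ε / 2))) :=
    (tendsto_nat_floor_mul_div_atTop (inv_nonneg.mpr hP.le)).mul_const _
  refine ⟨fun E => ⌊P⁻¹ * E⌋₊, fun E => c _, ?_, he.comp hn⟩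
  have hgt : R / P - ε < P⁻¹ * (R - P * ε / 2) := by
    rw [mul_sub, ← div_eq_inv_mul, ← div_eq_inv_mul]
    have : P * ε / 2 / P = ε / 2 := by field_simp
    linarith
  filter_upwards [hn.eventually hc, hn.eventually_gt_atTop 0, hlim.eventually_const_lt hgt,
    eventually_gt_atTop 0] with E hE hn0 hEgt hE0
  have hn0' : (0 : ℝ) < ⌊P⁻¹ * E⌋₊ := by exact_mod_cast hn0
  refine ⟨fun m => ?_, hEgt.trans ?_⟩
  · have h1 := hE.1 m
    rw [one_div, inv_mul_le_iff₀ hn0'] at h1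
    have h2 : (⌊P⁻¹ * E⌋₊ : ℝ) ≤ P⁻¹ * E := Nat.floor_le (by positivity)
    calc _ ≤ (⌊P⁻¹ * E⌋₊ : ℝ) * P := h1
      _ ≤ P⁻¹ * E * P := by gcongr
      _ = E := by field_simp
  · have h1 := hE.2
    rw [lt_div_iff₀ hn0'] at h1
    rw [lt_div_iff₀ hE0, div_mul_eq_mul_div, div_mul_cancel₀ _ hE0.ne']
    linarith

/-- The capacity per unit-energy is that of the channel without quantization. -/
lemma capacityPerEnergy_eq {v : ℝ≥0} (hv : 0 < v) : capacityPerEnergy v = 1 / (2 * v) := by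
  have hv' : (0 : ℝ) < v := by exact_mod_cast hv
  refine le_antisymm ((isLUB_capacityPerEnergy hv).2 fun _ hR => AchievableRatePerEnergy.le hv hR)
    (le_of_forall_lt fun b hb => ?_)
  obtain ⟨b', hb1, hb2⟩ := exists_between hb
  obtain ⟨P, hP, -, h⟩ := exists_capacity_ge hv (κ := b' * (2 * v))
    (by rwa [lt_div_iff₀ (by positivity)] at hb2) one_pos
  have h1 : capacity v P ≤ capacityPerEnergy v * P := (isLUB_capacity hv hP).2 fun R hR => by
    have := (isLUB_capacityPerEnergy hv).1 (AchievableRate.perEnergy hP hR)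
    rwa [div_le_iff₀ hP] at this
  have h2 : b' * (2 * v) * (P / (2 * v)) = b' * P := by field_simp
  rw [h2] at h
  exact hb1.trans_le (le_of_mul_le_mul_right (h.trans h1) hP)

lemma tendsto_div_relLoss : Tendsto (fun s : ℝ => s / relLoss s) (𝓝[>] 0) (𝓝 0) := by
  have h1 : Tendsto (fun s : ℝ => 36 * s - 64 * (Real.log s * s)) (𝓝[>] 0)
      (𝓝 (36 * 0 - 64 * 0)) := by
    have hid : Tendsto (fun s : ℝ => s) (𝓝[>] 0) (𝓝 0) := nhdsWithin_le_nhds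
    have := tendsto_log_mul_rpow_nhdsGT_zero one_pos
    simp only [Real.rpow_one] at this
    exact (hid.const_mul 36).sub (this.const_mul 64)
  rw [mul_zero, mul_zero, sub_zero] at h1
  refine h1.congr fun s => ?_
  simp only [relLoss, div_div_eq_mul_div, div_one]
  ring

lemma eventually_capacity_le {v : ℝ≥0} (hv : 0 < v) :
    ∀ᶠ s : ℝ in 𝓝[>] 0, 0 < s ∧ 0 < relLoss s ∧ relLoss s ≤ 1 / 2 ∧
      ∀ P, s ≤ P → capacity v P ≤ P / (2 * v) * (1 - relLoss s) := by
  have hv' : (0 : ℝ) < v := by exact_mod_cast hv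
  have h1 : 0 < min (1 / 2 : ℝ) (1 / (24 * (v : ℝ))) := lt_min (by norm_num) (by positivity)
  filter_upwards [Ioo_mem_nhdsGT h1] with s hs
  have hs2 := hs.2.le.trans (min_le_left _ _)
  exact ⟨hs.1, relLoss_pos hs.1 (by linarith), relLoss_le_half hs.1 (by linarith), fun P hP =>
    capacity_le_relLoss hv hs.1 hs2 (hs.2.le.trans (min_le_right _ _)) hP⟩

lemma tendsto_secondQuotient {v : ℝ≥0} (hv : 0 < v) :
    Tendsto (secondQuotient v) (𝓝[>] 0) (𝓝 ⊥) := by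
  have hv' : (0 : ℝ) < v := by exact_mod_cast hv
  unfold secondQuotient
  rw [EReal.tendsto_coe_nhds_bot_iff]
  have h1 : Tendsto (fun s : ℝ => -((v : ℝ)⁻¹ * (s / relLoss s)⁻¹)) (𝓝[>] 0) atBot := by
    refine tendsto_neg_atTop_atBot.comp (Tendsto.const_mul_atTop (inv_pos.mpr hv') ?_)
    refine tendsto_inv_nhdsGT_zero.comp (tendsto_nhdsWithin_iff.mpr ⟨tendsto_div_relLoss, ?_⟩)
    filter_upwards [eventually_capacity_le hv] with s hs
    exact div_pos hs.1 hs.2.1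
  refine tendsto_atBot_mono' _ ?_ h1
  filter_upwards [eventually_capacity_le hv] with s ⟨hs, hl, _, hC⟩
  have h2 := hC s le_rfl
  rw [capacityPerEnergy_eq hv]
  have h3 : (capacity v s - s * (1 / (2 * v))) / s ^ 2 ≤ (-(s / (2 * v) * relLoss s)) / s ^ 2 := by
    refine div_le_div_of_nonneg_right ?_ (by positivity)
    rw [mul_one_div]; linarith
  refine (mul_le_mul_of_nonneg_left h3 two_pos.le).trans (le_of_eq ?_)
  field_simp

lemma energyPerBit_eq (v : ℝ≥0) (P : ℝ) :
    energyPerBit v P = Real.log 2 * (P / (2 * v) / capacity v P) := by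
  unfold energyPerBit
  ring

/-- At the powers `P ≥ s` the energy per bit is bounded away from `log 2`. -/
lemma le_energyPerBit {v : ℝ≥0} (hv : 0 < v) {P l : ℝ} (hP : 0 < P) (hl : l ≤ 1 / 2)
    (h : capacity v P ≤ P / (2 * v) * (1 - l)) :
    Real.log 2 * (1 / (1 - l)) ≤ energyPerBit v P := by
  rw [energyPerBit_eq]
  refine mul_le_mul_of_nonneg_left ?_ (Real.log_nonneg one_le_two)
  rw [div_le_div_iff₀ (by linarith) (capacity_pos hv hP)]
  linarith

lemma log_two_lt_energyPerBit {v : ℝ≥0} (hv : 0 < v) {P : ℝ} (hP : 0 < P) :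
    Real.log 2 < energyPerBit v P := by
  obtain ⟨s, ⟨hs, hl, hl2, hC⟩, hsP⟩ :=
    ((eventually_capacity_le hv).and (Ioo_mem_nhdsGT hP)).exists
  refine lt_of_lt_of_le ?_ (le_energyPerBit hv hP hl2 (hC P hsP.2.le))
  refine lt_mul_of_one_lt_right (Real.log_pos one_lt_two) ?_
  rw [one_lt_div (by linarith)]
  linarith

lemma exists_energyPerBit_lt {v : ℝ≥0} (hv : 0 < v) {b : ℝ} (hb : Real.log 2 < b) :
    ∃ P, 0 < P ∧ energyPerBit v P < b := by
  have hlog : 0 < Real.log 2 := Real.log_pos one_lt_two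
  have hv' : (0 : ℝ) < v := by exact_mod_cast hv
  obtain ⟨κ, hκ1, hκ2⟩ := exists_between ((div_lt_one (hlog.trans hb)).mpr hb)
  have hκ0 : 0 < κ := (div_pos hlog (hlog.trans hb)).trans hκ1
  obtain ⟨P, hP, -, h⟩ := exists_capacity_ge hv hκ2 one_pos
  refine ⟨P, hP, ?_⟩
  rw [energyPerBit_eq, ← mul_div_assoc, div_lt_iff₀ (capacity_pos hv hP)]
  rw [div_lt_iff₀ (hlog.trans hb)] at hκ1
  have hx : 0 < P / (2 * v) := by positivity
  calc Real.log 2 * (P / (2 * v)) < κ * b * (P / (2 * v)) := by gcongr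
    _ = b * (κ * (P / (2 * v))) := by ring
    _ ≤ b * capacity v P := mul_le_mul_of_nonneg_left h (hlog.trans hb).le

lemma minEnergyPerBit_eq {v : ℝ≥0} (hv : 0 < v) : minEnergyPerBit v = Real.log 2 := by
  refine csInf_eq_of_forall_ge_of_forall_gt_exists_lt ⟨_, mem_image_of_mem _ (mem_Ioi.mpr one_pos)⟩
    ?_ ?_
  · rintro _ ⟨P, hP, rfl⟩
    exact (log_two_lt_energyPerBit hv hP).le
  · intro b hb
    obtain ⟨P, hP, h⟩ := exists_energyPerBit_lt hv hb
    exact ⟨_, mem_image_of_mem _ hP, h⟩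

lemma widebandFilter_neBot {v : ℝ≥0} (hv : 0 < v) : (widebandFilter v).NeBot := by
  unfold widebandFilter
  rw [minEnergyPerBit_eq hv, (((nhdsGT_basis _).comap _).inf_principal _).neBot_iff]
  intro b hb
  obtain ⟨P, hP, h⟩ := exists_energyPerBit_lt hv hb
  exact ⟨P, ⟨log_two_lt_energyPerBit hv hP, h⟩, hP⟩

/-- When the energy per bit decreases to its minimum, the power tends to zero. -/
lemma widebandFilter_le {v : ℝ≥0} (hv : 0 < v) : widebandFilter v ≤ 𝓝[>] 0 := by
  have hpos : ∀ᶠ P in widebandFilter v, 0 < P := mem_inf_of_right (mem_principal_self _)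
  have he : Tendsto (energyPerBit v) (widebandFilter v) (𝓝 (Real.log 2)) := by
    have h : Tendsto (energyPerBit v) (widebandFilter v) (𝓝[>] (minEnergyPerBit v)) :=
      tendsto_comap.mono_left inf_le_left
    rw [minEnergyPerBit_eq hv] at h
    exact h.mono_right nhdsWithin_le_nhds
  refine (nhdsGT_basis (0 : ℝ)).ge_iff.mpr fun b hb => ?_
  obtain ⟨s, ⟨hs, hl, hl2, hC⟩, hsb⟩ :=
    ((eventually_capacity_le hv).and (Ioo_mem_nhdsGT hb)).exists
  have hgt : Real.log 2 < Real.log 2 * (1 / (1 - relLoss s)) := by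
    refine lt_mul_of_one_lt_right (Real.log_pos one_lt_two) ?_
    rw [one_lt_div (by linarith)]
    linarith
  filter_upwards [hpos, he.eventually_lt_const hgt] with P hP hPlt
  refine ⟨hP, (lt_of_not_ge fun hsP => ?_ : P < s).trans hsb.2⟩
  exact absurd (le_energyPerBit hv hP hl2 (hC P hsP)) (not_le.mpr hPlt)

lemma dB_sub_dB {x y : ℝ} (hx : 0 < x) (hy : 0 < y) :
    dB x - dB y = 10 / Real.log 10 * Real.log (x / y) := by
  rw [dB, dB, Real.logb, Real.logb, Real.log_div hx.ne' hy.ne']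
  ring

lemma hasWidebandSlope_zero {v : ℝ≥0} (hv : 0 < v) : HasWidebandSlope v 0 := by
  refine ⟨widebandFilter_neBot hv, Tendsto.mono_left ?_ (widebandFilter_le hv)⟩
  have hv' : (0 : ℝ) < v := by exact_mod_cast hv
  have hlog2 : 0 < Real.log 2 := Real.log_pos one_lt_two
  have hlog10 : 0 < Real.log 10 := Real.log_pos (by norm_num)
  have hdB2 : 0 ≤ dB 2 := by
    have : 0 ≤ Real.logb 10 2 := div_nonneg hlog2.le hlog10.le
    unfold dB; positivity
  set K := 2 / Real.log 2 / (2 * v) / (10 / Real.log 10) * dB 2 with hK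
  have hlim : Tendsto (fun s : ℝ => K * (s / relLoss s)) (𝓝[>] 0) (𝓝 0) := by
    simpa using tendsto_div_relLoss.const_mul K
  refine squeeze_zero' ?_ ?_ hlim
  all_goals
    filter_upwards [eventually_capacity_le hv] with P ⟨hP, hl, hl2, hC⟩
    have hC0 := capacity_pos hv hP
    have he := log_two_lt_energyPerBit hv hP
    have hratio : energyPerBit v P / Real.log 2 = P / (2 * v) / capacity v P := by
      rw [energyPerBit_eq]; field_simp
    have hgap : relLoss P ≤ Real.log (energyPerBit v P / Real.log 2) := by
      rw [hratio]
      refine le_trans ?_ (Real.one_sub_inv_le_log_of_pos (by positivity))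
      rw [inv_div, le_sub_comm, div_le_iff₀ (by positivity)]
      linarith [hC P le_rfl]
    rw [minEnergyPerBit_eq hv, dB_sub_dB (hlog2.trans he) hlog2, spectralEfficiency]
  · have := hl.le.trans hgap
    positivity
  · have hCle : capacity v P ≤ P / (2 * v) :=
      (hC P le_rfl).trans (mul_le_of_le_one_right (by positivity) (by linarith))
    calc _ ≤ 2 / Real.log 2 * (P / (2 * v)) / (10 / Real.log 10 * relLoss P) * dB 2 := by
          gcongr
      _ = K * (P / relLoss P) := by rw [hK]; field_simp

end OneBit

theorem mainTheorem5 (v : ℝ≥0) (hv : 0 < v) :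
    -- the suprema defining the capacities are genuine (finite) least upper bounds
    (∀ P : ℝ, 0 < P → IsLUB {R | OneBit.AchievableRate v P R} (OneBit.capacity v P)) ∧
    IsLUB {R | OneBit.AchievableRatePerEnergy v R} (OneBit.capacityPerEnergy v) ∧
    -- the second derivative of the capacity at zero power exists and is `-∞`
    Tendsto (OneBit.secondQuotient v) (𝓝[>] (0 : ℝ)) (𝓝 (OneBit.capacitySecondDeriv v)) ∧
    OneBit.capacitySecondDeriv v = ⊥ ∧
    -- the wideband slope is zero, as a slope and through its expression by `Ċ(0)` and `C̈(0)`
    OneBit.HasWidebandSlope v 0 ∧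
    4 * (OneBit.capacityPerEnergy v : EReal) ^ 2 / (-OneBit.capacitySecondDeriv v) = 0 := by
  have hlim := OneBit.tendsto_secondQuotient hv
  have hbot : OneBit.capacitySecondDeriv v = ⊥ := hlim.limUnder_eq
  refine ⟨fun P hP => OneBit.isLUB_capacity hv hP, OneBit.isLUB_capacityPerEnergy hv,
    hbot.symm ▸ hlim, hbot, OneBit.hasWidebandSlope_zero hv, ?_⟩
  rw [hbot, EReal.neg_bot, EReal.div_top]
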